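/- Let $G$ be a finite cyclic group (written additively) of order at least $2000$. Then $$\Delta^{*}(G)\cap \mathbb{N}_{\ge |G|/10} \;=\; \Bigl(\,\bigcup_{m\,\mid\,|G|} I(m)\Bigr)\cap \mathbb{N}_{\ge |G|/10},$$ where the notation is as follows. For a positive integer $m$, let $M(m)$ be the set of all triples $(c_1,c_2,d)$ of positive integers with $c_1,c_2\in[1,m]$ and $d\mid m$ such that $$\frac{m-c_1-c_2}{c_1c_2}\qquad\text{and}\qquad \frac{(m-c_1-c_2)\,d}{c_2\,m}$$ are both positive integers, and let $I(m)$ be the set of all positive integers of the form $$\gcd\Bigl\{\frac{m-c_1-c_2}{c_1c_2},\ \frac{(m-c_1-c_2)\,d}{c_2\,m}\Bigr\}\qquad\text{with } (c_1,c_2,d)\in M(m).$$ Let $\mathcal{B}(G)$ be the monoid of zero-sum sequences over $G$, that is, the submonoid of the free abelian monoid with basis $G$ that consists of the finite (unordered, repetition allowed) sequences of elements of $G$ whose sum is $0$. For an element $a$ of a commutative cancellative monoid $S$, let $\mathsf{L}_S(a)$ be the set of all $\ell\ge 0$ such that $a$ is, up to a unit, a product of $\ell$ irreducible elements of $S$.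 For $L\subset\mathbb{N}_0$ let $\Delta(L)$ be the set of all differences $\ell'-\ell$ with $\ell<\ell'$ in $L$ and no element of $L$ strictly between $\ell$ and $\ell'$, and let $\Delta(S)=\bigcup_{a\in S}\Delta(\mathsf{L}_S(a))$. A submonoid $S\subset\mathcal{B}(G)$ is divisor closed if every divisor in $\mathcal{B}(G)$ of an element of $S$ belongs to $S$. Finally, the set of minimal distances of $G$ is $$\Delta^{*}(G)=\{\min\Delta(S)\colon S\subset\mathcal{B}(G)\text{ a divisor closed submonoid with }\Delta(S)\neq\emptyset\}.$$ -/

import Mathlib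

namespace Factorization

section Monoids

variable {H : Type*} [CommMonoid H]

/-- The set of lengths `L(a)` of an element `a` of a commutative monoid: all `l` such that `a` is,
up to a unit, a product of `l` irreducible elements (counted with multiplicity). It is `{0}` if
`a` is a unit. -/
def lengths (a : H) : Set ℕ :=
  {l | ∃ z : Multiset H, (∀ u ∈ z, Irreducible u) ∧ Associated z.prod a ∧ Multiset.card z = l}

/-- The set `Δ(L)` of successive distances of a set `L` of natural numbers: all `l' - l`, where
`l < l'` are elements of `L` with no element of `L` strictly in between. -/
def successiveDistances (L : Set ℕ) : Set ℕ :=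
  {d | ∃ l ∈ L, ∃ l' ∈ L, l < l' ∧ (∀ x ∈ L, ¬ (l < x ∧ x < l')) ∧ l' = l + d}

/-- The set of distances `Δ(H)` of a commutative monoid: the union of the sets of successive
distances of the sets of lengths of its elements. -/
def distances (H : Type*) [CommMonoid H] : Set ℕ :=
  ⋃ a : H, successiveDistances (lengths a)

/-- A submonoid `S` of `H` is divisor closed if every divisor in `H` of an element of `S`
belongs to `S`. -/
def DivisorClosed (S : Submonoid H) : Prop :=
  ∀ a ∈ S, ∀ b : H, b ∣ a → b ∈ S

/-- The set of minimal distances `Δ*(H)`: the minima of the sets `Δ(S)`, where `S` runs through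
the divisor closed submonoids of `H` with `Δ(S)` non-empty. (`Δ(S)` is formed in the monoid `S`
itself; `IsLeast` includes that `Δ(S)` is non-empty.) -/
def minimalDistances (H : Type*) [CommMonoid H] : Set ℕ :=
  {d | ∃ S : Submonoid H, DivisorClosed S ∧ IsLeast (distances S) d}

end Monoids

/-- The monoid of zero-sum sequences over an additive abelian group `G`. A sequence is a finite
multiset of elements of `G`, i.e. an element of the free abelian monoid with basis `G`, here
written multiplicatively; it has sum zero if the sum of its terms is `0`. -/
def zeroSumMonoid (G : Type*) [AddCommGroup G] : Submonoid (Multiplicative (Multiset G)) where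
  carrier := {S | (Multiplicative.toAdd S).sum = 0}
  one_mem' := by simp
  mul_mem' := by
    intro S T hS hT
    change (Multiplicative.toAdd S).sum = 0 at hS
    change (Multiplicative.toAdd T).sum = 0 at hT
    change (Multiplicative.toAdd (S * T)).sum = 0
    rw [toAdd_mul, Multiset.sum_add, hS, hT, add_zero]

/-- The set of minimal distances `Δ*(G)` of an abelian group `G`, that is, of the monoid of
zero-sum sequences over `G`. -/
def groupMinimalDistances (G : Type*) [AddCommGroup G] : Set ℕ :=
  minimalDistances (zeroSumMonoid G)

/-- The fraction `(n - c₁ - c₂) / (c₁ c₂)`. -/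
def frac₁ (n c₁ c₂ : ℕ) : ℚ :=
  ((n : ℚ) - c₁ - c₂) / (c₁ * c₂)

/-- The fraction `(n - c₁ - c₂) d / (c₂ n)`. -/
def frac₂ (n c₁ c₂ d : ℕ) : ℚ :=
  ((n : ℚ) - c₁ - c₂) * d / (c₂ * n)

/-- The rational number `q` is a positive integer. -/
def IsPosInt (q : ℚ) : Prop :=
  ∃ a : ℕ, 0 < a ∧ (a : ℚ) = q

/-- The set `M(n)` of all triples `(c₁, c₂, d)` of positive integers such that `c₁` and `c₂` lie
in `[1, n]`, `d` divides `n`, and both fractions are positive integers. -/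
def tripleSet (n : ℕ) : Set (ℕ × ℕ × ℕ) :=
  {t | 1 ≤ t.1 ∧ t.1 ≤ n ∧ 1 ≤ t.2.1 ∧ t.2.1 ≤ n ∧ 1 ≤ t.2.2 ∧ t.2.2 ∣ n ∧
    IsPosInt (frac₁ n t.1 t.2.1) ∧ IsPosInt (frac₂ n t.1 t.2.1 t.2.2)}

/-- The set `I(n)` of the greatest common divisors of the two fractions, for the triples in
`M(n)`. -/
def gcdSet (n : ℕ) : Set ℕ :=
  {k | ∃ c₁ c₂ d : ℕ, (c₁, c₂, d) ∈ tripleSet n ∧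
    ∃ a b : ℕ, (a : ℚ) = frac₁ n c₁ c₂ ∧ (b : ℚ) = frac₂ n c₁ c₂ d ∧ k = Nat.gcd a b}

end Factorization

/-! Write n = |G| and call minimal zero-sum sequences atoms. A divisor closed submonoid consists of
all zero-sum sequences over some subset G₀, and min Δ is the positive generator D of the group of
differences of factorization lengths over G₀ (`mem_groupMinimalDistances_iff`). On the arithmetic
side, k ∈ I(m) means m = q(1 + Lk) + ρ with L = lcm(ρ, κ) and κ ∣ m (`mem_gcdSet_iff`).

The inclusion ⊇ needs no size condition. Take e of order m and G₀ = {e, (1 + Lk)e, (m/κ)e}.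
Represent each multiple of e by its coefficient in [1, m] and let the norm of a zero-sum sequence be
its sum of coefficients divided by m. The norm is additive, so if every atom has norm ≡ 1 mod k,
then all length differences are divisible by k (`norm_modEq_one_core`, `lengthsCongr_triple`). An
atom of norm 1 + k makes k itself a length difference (`isLengthGenerator_triple`).

For ⊆, suppose 10D ≥ n. Some abelian group carries a weight under which all atoms over G₀ have the
same weight u, with ku = 0 only for D ∣ k. For g, h ∈ G₀ there are multiples xg and yh = αxg that
generate the same group, of order N. The weight forces the norm with respect to xg of every atom in
xg and yh to be ≡ 1 mod D. Two such atoms give α = 1 or N = qα + ρ with α = 1 + ρtD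
(`IsLengthWeight.pair_structure`). If α = 1 for all pairs, every atom has cross number 1 and no two
lengths differ (`exists_pairData_ne_one`). Otherwise n ≤ 10D leaves few parameters, and most of them
give D ∈ I(m) for some m ∣ n. In the remaining cases n = ctD + c + 1; further atoms show that G₀
contains at most 0, a generator e, -ce and, if c = 1, the element of order two. By the first half,
all length differences are then divisible by tD or by tD/2 with t ≥ 3, which exceeds D: a
contradiction. -/

namespace Factorization

/-! ### Atoms over a subset and the group of length differences -/

section MinimalZeroSum

variable {G : Type*} [AddCommGroup G]

/-- `A` is a minimal zero-sum sequence over `G₀`. -/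
structure MinZeroSum (G₀ : Set G) (A : Multiset G) : Prop where
  ne_zero : A ≠ 0
  sum_eq : A.sum = 0
  mem : ∀ g ∈ A, g ∈ G₀
  minimal : ∀ B ≤ A, B.sum = 0 → B = 0 ∨ B = A

/-- Any two factorizations over `G₀` of the same zero-sum sequence have lengths that are congruent
modulo `d`. -/
def LengthsCongr (G₀ : Set G) (d : ℕ) : Prop :=
  ∀ z z' : Multiset (Multiset G), (∀ A ∈ z, MinZeroSum G₀ A) → (∀ A ∈ z', MinZeroSum G₀ A) →
    z.sum = z'.sum → (d : ℤ) ∣ (Multiset.card z : ℤ) - Multiset.card z'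

/-- `D` is the positive generator of the group of length differences over `G₀`. -/
structure IsLengthGenerator (G₀ : Set G) (D : ℕ) : Prop where
  pos : 0 < D
  congr : LengthsCongr G₀ D
  attained : ∃ z z' : Multiset (Multiset G), (∀ A ∈ z, MinZeroSum G₀ A) ∧
    (∀ A ∈ z', MinZeroSum G₀ A) ∧ z.sum = z'.sum ∧
    (Multiset.card z : ℤ) = Multiset.card z' + D

/-- The subgroup of `ℤ` of all length differences over `G₀`. -/
def lengthDifferences (G₀ : Set G) : AddSubgroup ℤ where
  carrier := {t | ∃ z z' : Multiset (Multiset G), (∀ A ∈ z, MinZeroSum G₀ A) ∧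
    (∀ A ∈ z', MinZeroSum G₀ A) ∧ z.sum = z'.sum ∧ (Multiset.card z : ℤ) = Multiset.card z' + t}
  zero_mem' := ⟨0, 0, by simp, by simp, rfl, by simp⟩
  add_mem' := by
    rintro s t ⟨z, z', hz, hz', h, hs⟩ ⟨w, w', hw, hw', k, ht⟩
    refine ⟨z + w, z' + w', ?_, ?_, by simp [h, k], by push_cast [Multiset.card_add]; linarith⟩
    · intro A hA
      exact (Multiset.mem_add.1 hA).elim (hz A) (hw A)
    · intro A hA
      exact (Multiset.mem_add.1 hA).elim (hz' A) (hw' A)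
  neg_mem' := by
    rintro t ⟨z, z', hz, hz', h, ht⟩
    exact ⟨z', z, hz', hz, h.symm, by linarith⟩

theorem exists_isLengthGenerator {G₀ : Set G} {t : ℤ} (ht : t ∈ lengthDifferences G₀)
    (h0 : t ≠ 0) : ∃ D, IsLengthGenerator G₀ D := by
  obtain ⟨a, ha⟩ := Int.subgroup_cyclic (lengthDifferences G₀)
  rw [← AddSubgroup.zmultiples_eq_closure] at ha
  have ha0 : a ≠ 0 := by
    rintro rfl
    rw [ha, AddSubgroup.mem_zmultiples_iff] at ht
    obtain ⟨k, hk⟩ := ht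
    simp at hk
    exact h0 hk.symm
  refine ⟨a.natAbs, Int.natAbs_pos.2 ha0, ?_, ?_⟩
  · intro z z' hz hz' h
    have : (Multiset.card z : ℤ) - Multiset.card z' ∈ lengthDifferences G₀ :=
      ⟨z, z', hz, hz', h, by ring⟩
    rw [ha, AddSubgroup.mem_zmultiples_iff] at this
    obtain ⟨k, hk⟩ := this
    rw [Int.natAbs_dvd, ← hk]
    exact ⟨k, by simp [mul_comm]⟩
  · have : ((a.natAbs : ℕ) : ℤ) ∈ lengthDifferences G₀ := by
      rw [ha, AddSubgroup.mem_zmultiples_iff]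
      rcases Int.natAbs_eq a with h | h
      · exact ⟨1, by simpa using h⟩
      · exact ⟨-1, by rw [neg_one_zsmul]; omega⟩
    exact this

end MinimalZeroSum

/-! ### From divisor closed submonoids to subsets of the group -/

section Bridge

variable {G : Type*} [AddCommGroup G] {S : Submonoid (zeroSumMonoid G)} {G₀ : Set G}

/-- The underlying multiset of an element of a monoid of zero-sum sequences. -/
def seq (a : S) : Multiset G := Multiplicative.toAdd a.1.1

theorem seq_injective : Function.Injective (seq : S → Multiset G) := fun _ _ h =>
  Subtype.ext (Subtype.ext h)

theorem seq_one : seq (1 : S) = 0 := rfl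

theorem seq_mul (a b : S) : seq (a * b) = seq a + seq b := rfl

theorem seq_sum (a : S) : (seq a).sum = 0 := a.1.2

theorem seq_prod (z : Multiset S) : seq z.prod = (z.map seq).sum := by
  induction z using Multiset.induction_on with
  | empty => simp [seq_one]
  | cons a s ih => simp [seq_mul, ih]

theorem exists_seq (hS : ∀ a : zeroSumMonoid G, a ∈ S ↔ ∀ g ∈ Multiplicative.toAdd a.1, g ∈ G₀)
    {A : Multiset G} (hA : A.sum = 0) (h : ∀ g ∈ A, g ∈ G₀) : ∃ a : S, seq a = A :=
  ⟨⟨⟨Multiplicative.ofAdd A, hA⟩, (hS _).2 h⟩, rfl⟩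

theorem isUnit_iff_seq (a : S) : IsUnit a ↔ seq a = 0 := by
  constructor
  · rintro ⟨u, rfl⟩
    have := congrArg seq u.mul_inv
    rw [seq_mul, seq_one] at this
    exact (add_eq_zero.1 this).1
  · intro h
    rw [show a = 1 from seq_injective h]
    exact isUnit_one

theorem associated_iff_eq_seq {a b : S} : Associated a b ↔ a = b := by
  constructor
  · rintro ⟨u, rfl⟩
    have := (isUnit_iff_seq (u : S)).1 u.isUnit
    exact seq_injective (by rw [seq_mul, this, add_zero])
  · rintro rfl
    rfl

theorem irreducible_iff_minZeroSum
    (hS : ∀ a : zeroSumMonoid G, a ∈ S ↔ ∀ g ∈ Multiplicative.toAdd a.1, g ∈ G₀) (a : S) :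
    Irreducible a ↔ MinZeroSum G₀ (seq a) := by
  have hmem : ∀ g ∈ seq a, g ∈ G₀ := (hS a.1).1 a.2
  rw [irreducible_iff, isUnit_iff_seq]
  constructor
  · rintro ⟨h0, h⟩
    refine ⟨h0, seq_sum a, hmem, fun B hB hB0 => ?_⟩
    obtain ⟨C, hC⟩ := Multiset.le_iff_exists_add.1 hB
    have hC0 : C.sum = 0 := by
      have := seq_sum a
      rwa [hC, Multiset.sum_add, hB0, zero_add] at this
    obtain ⟨b, hb⟩ := exists_seq hS hB0 fun g hg => hmem g (by rw [hC]; simp [hg])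
    obtain ⟨c, hc⟩ := exists_seq hS hC0 fun g hg => hmem g (by rw [hC]; simp [hg])
    rcases h (a := b) (b := c) (seq_injective (by rw [seq_mul, hb, hc, hC])) with h | h
    · left; rwa [isUnit_iff_seq, hb] at h
    · right
      rw [isUnit_iff_seq, hc] at h
      rw [hC, h, add_zero]
  · intro h
    refine ⟨h.ne_zero, ?_⟩
    rintro b c rfl
    rw [isUnit_iff_seq, isUnit_iff_seq]
    rcases h.minimal (seq b) (by rw [seq_mul]; exact Multiset.le_add_right _ _) (seq_sum b)
      with h | h
    · exact Or.inl h
    · right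
      rw [seq_mul] at h
      simpa using h

theorem mem_lengths_iff
    (hS : ∀ a : zeroSumMonoid G, a ∈ S ↔ ∀ g ∈ Multiplicative.toAdd a.1, g ∈ G₀) (a : S) (l : ℕ) :
    l ∈ lengths a ↔ ∃ z : Multiset (Multiset G), (∀ A ∈ z, MinZeroSum G₀ A) ∧ z.sum = seq a ∧
      Multiset.card z = l := by
  constructor
  · rintro ⟨z, hz, hza, rfl⟩
    refine ⟨z.map seq, ?_, ?_, by simp⟩
    · intro A hA
      obtain ⟨b, hb, rfl⟩ := Multiset.mem_map.1 hA
      exact (irreducible_iff_minZeroSum hS b).1 (hz b hb)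
    · rw [← seq_prod, associated_iff_eq_seq.1 hza]
  · rintro ⟨z, hz, hza, rfl⟩
    have : ∃ w : Multiset S, w.map seq = z := by
      clear hza
      induction z using Multiset.induction_on with
      | empty => exact ⟨0, rfl⟩
      | cons A s ih =>
        obtain ⟨w, hw⟩ := ih fun B hB => hz B (Multiset.mem_cons_of_mem hB)
        have hA := hz A (Multiset.mem_cons_self A s)
        obtain ⟨b, hb⟩ := exists_seq hS hA.sum_eq hA.mem
        exact ⟨b ::ₘ w, by simp [hb, hw]⟩
    obtain ⟨w, rfl⟩ := this
    refine ⟨w, ?_, ?_, by simp⟩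
    · intro b hb
      exact (irreducible_iff_minZeroSum hS b).2 (hz _ (Multiset.mem_map_of_mem _ hb))
    · rw [associated_iff_eq_seq]
      exact seq_injective (by rw [seq_prod, hza])

theorem sum_sum_eq_zero {z : Multiset (Multiset G)} (hz : ∀ A ∈ z, MinZeroSum G₀ A) :
    z.sum.sum = 0 ∧ ∀ g ∈ z.sum, g ∈ G₀ := by
  induction z using Multiset.induction_on with
  | empty => simp
  | cons A s ih =>
    have hA := hz A (Multiset.mem_cons_self A s)
    obtain ⟨h1, h2⟩ := ih fun B hB => hz B (Multiset.mem_cons_of_mem hB)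
    refine ⟨by simp [hA.sum_eq, h1], fun g hg => ?_⟩
    rw [Multiset.sum_cons, Multiset.mem_add] at hg
    exact hg.elim (hA.mem g) (h2 g)

/-- All lengths of one element are congruent modulo D, so every distance is at least D. Two lengths
that differ by exactly D have no length between them. -/
theorem isLeast_distances
    (hS : ∀ a : zeroSumMonoid G, a ∈ S ↔ ∀ g ∈ Multiplicative.toAdd a.1, g ∈ G₀) {D : ℕ}
    (hD : IsLengthGenerator G₀ D) : IsLeast (distances S) D := by
  have key : ∀ (a : S) (l l' : ℕ), l ∈ lengths a → l' ∈ lengths a → (D : ℤ) ∣ (l : ℤ) - l' := by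
    intro a l l' hl hl'
    obtain ⟨z, hz, h, rfl⟩ := (mem_lengths_iff hS a l).1 hl
    obtain ⟨z', hz', h', rfl⟩ := (mem_lengths_iff hS a l').1 hl'
    exact hD.congr z z' hz hz' (h.trans h'.symm)
  constructor
  · obtain ⟨z, z', hz, hz', h, hc⟩ := hD.attained
    obtain ⟨h1, h2⟩ := sum_sum_eq_zero hz
    obtain ⟨a, ha⟩ := exists_seq hS h1 h2
    have hp := hD.pos
    refine Set.mem_iUnion.2 ⟨a, Multiset.card z', ?_, Multiset.card z, ?_, by omega, ?_, by omega⟩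
    · exact (mem_lengths_iff hS a _).2 ⟨z', hz', by rw [ha, h], rfl⟩
    · exact (mem_lengths_iff hS a _).2 ⟨z, hz, ha.symm, rfl⟩
    · rintro x hx ⟨hx1, hx2⟩
      have := key a x (Multiset.card z') hx
        ((mem_lengths_iff hS a _).2 ⟨z', hz', by rw [ha, h], rfl⟩)
      have := Int.le_of_dvd (by omega) this
      omega
  · intro d hd
    obtain ⟨a, l, hl, l', hl', hlt, -, rfl⟩ := Set.mem_iUnion.1 hd
    have := Int.le_of_dvd (by omega) (key a _ l hl' hl)
    omega

theorem isLeast_distances_iff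
    (hS : ∀ a : zeroSumMonoid G, a ∈ S ↔ ∀ g ∈ Multiplicative.toAdd a.1, g ∈ G₀) {D : ℕ} :
    IsLeast (distances S) D ↔ IsLengthGenerator G₀ D := by
  refine ⟨fun h => ?_, isLeast_distances hS⟩
  obtain ⟨a, l, hl, l', hl', hlt, -, hd⟩ := Set.mem_iUnion.1 h.1
  obtain ⟨z, hz, hza, rfl⟩ := (mem_lengths_iff hS a l).1 hl
  obtain ⟨z', hz', hza', rfl⟩ := (mem_lengths_iff hS a l').1 hl'
  have : (D : ℤ) ∈ lengthDifferences G₀ :=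
    ⟨z', z, hz', hz, hza'.trans hza.symm, by omega⟩
  obtain ⟨D', hD'⟩ := exists_isLengthGenerator this (by omega)
  rwa [h.unique (isLeast_distances hS hD')]

/-- The monoid of zero-sum sequences over a subset `G₀`, as a submonoid. -/
def zeroSumSubmonoid (G₀ : Set G) : Submonoid (zeroSumMonoid G) where
  carrier := {a | ∀ g ∈ Multiplicative.toAdd a.1, g ∈ G₀}
  one_mem' := by
    intro g hg
    exact absurd hg (Multiset.notMem_zero g)
  mul_mem' := by
    intro a b ha hb g hg
    exact (Multiset.mem_add.1 hg).elim (ha g) (hb g)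

theorem divisorClosed_zeroSumSubmonoid (G₀ : Set G) : DivisorClosed (zeroSumSubmonoid G₀) := by
  rintro _ ha b ⟨c, rfl⟩ g hg
  exact ha g (Multiset.mem_add.2 (Or.inl hg))

/-- G₀ is the set of all terms that occur in S. If g occurs in b ∈ S, then g^(ord g) divides b^(ord
g) and lies in S; products of such powers are multiples of any given zero-sum sequence over G₀. -/
theorem exists_support_of_divisorClosed [Finite G] (hS : DivisorClosed S) :
    ∃ G₀ : Set G, ∀ a : zeroSumMonoid G, a ∈ S ↔ ∀ g ∈ Multiplicative.toAdd a.1, g ∈ G₀ := by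
  refine ⟨{g | ∃ a ∈ S, g ∈ Multiplicative.toAdd (a : zeroSumMonoid G).1}, fun a =>
    ⟨fun ha g hg => ⟨a, ha, hg⟩, fun h => ?_⟩⟩
  have hpow : ∀ g ∈ Multiplicative.toAdd a.1, ∃ b ∈ S,
      Multiplicative.toAdd (b : zeroSumMonoid G).1 = Multiset.replicate (addOrderOf g) g := by
    intro g hg
    obtain ⟨b, hb, hgb⟩ := h g hg
    have hsum : (Multiset.replicate (addOrderOf g) g).sum = 0 := by
      simp [addOrderOf_nsmul_eq_zero]
    refine ⟨⟨Multiplicative.ofAdd (Multiset.replicate (addOrderOf g) g), hsum⟩, ?_, rfl⟩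
    refine hS (b ^ addOrderOf g) (pow_mem hb _) _ ?_
    have hle : Multiset.replicate (addOrderOf g) g ≤
        addOrderOf g • Multiplicative.toAdd b.1 := by
      rw [← Multiset.nsmul_singleton]
      exact nsmul_le_nsmul_right (Multiset.singleton_le.2 hgb) _
    obtain ⟨C, hC⟩ := Multiset.le_iff_exists_add.1 hle
    have hC0 : C.sum = 0 := by
      have h1 : (addOrderOf g • Multiplicative.toAdd b.1).sum = 0 := by
        rw [Multiset.sum_nsmul, show (Multiplicative.toAdd b.1).sum = 0 from b.2, nsmul_zero]
      rwa [hC, Multiset.sum_add, hsum, zero_add] at h1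
    refine ⟨⟨Multiplicative.ofAdd C, hC0⟩, Subtype.ext ?_⟩
    exact hC
  have main : ∀ A : Multiset G, (∀ g ∈ A, ∃ b ∈ S,
      Multiplicative.toAdd (b : zeroSumMonoid G).1 = Multiset.replicate (addOrderOf g) g) →
      ∃ b ∈ S, A ≤ Multiplicative.toAdd (b : zeroSumMonoid G).1 := by
    intro A
    induction A using Multiset.induction_on with
    | empty => exact fun _ => ⟨1, one_mem _, Multiset.zero_le _⟩
    | cons g s ih =>
      intro hA
      obtain ⟨b, hb, hsb⟩ := ih fun x hx => hA x (Multiset.mem_cons_of_mem hx)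
      obtain ⟨c, hc, hgc⟩ := hA g (Multiset.mem_cons_self g s)
      refine ⟨c * b, mul_mem hc hb, ?_⟩
      change g ::ₘ s ≤ Multiplicative.toAdd c.1 + Multiplicative.toAdd b.1
      rw [← Multiset.singleton_add]
      refine add_le_add ?_ hsb
      rw [hgc, Multiset.singleton_le]
      exact Multiset.mem_replicate.2 ⟨(addOrderOf_pos g).ne', rfl⟩
  obtain ⟨b, hb, hab⟩ := main _ hpow
  refine hS b hb a ?_
  obtain ⟨C, hC⟩ := Multiset.le_iff_exists_add.1 hab
  have hC0 : C.sum = 0 := by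
    have h1 : (Multiplicative.toAdd b.1).sum = 0 := b.2
    rwa [hC, Multiset.sum_add, show (Multiplicative.toAdd a.1).sum = 0 from a.2, zero_add] at h1
  exact ⟨⟨Multiplicative.ofAdd C, hC0⟩, Subtype.ext hC⟩

theorem mem_groupMinimalDistances_iff [Finite G] {D : ℕ} :
    D ∈ groupMinimalDistances G ↔ ∃ G₀ : Set G, IsLengthGenerator G₀ D := by
  constructor
  · rintro ⟨S, hS, hD⟩
    obtain ⟨G₀, h⟩ := exists_support_of_divisorClosed hS
    exact ⟨G₀, (isLeast_distances_iff h).1 hD⟩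
  · rintro ⟨G₀, h⟩
    exact ⟨zeroSumSubmonoid G₀, divisorClosed_zeroSumSubmonoid G₀,
      isLeast_distances (fun _ => Iff.rfl) h⟩

end Bridge

/-! ### Norms of atoms over e, (1 + Lk)e, (m/κ)e, in terms of exponents -/

section Arithmetic

/-- With w = κ'(y - lγq₁) + zq₁, which is additive in (y, z, l), the norm equation becomes κ'x + w +
zρ₁ = κ'γρ₁(l - wk). Hence l ≡ 1 mod k will follow from l - wk = 1. -/
theorem weight_identity {γ κ' q₁ ρ₁ k x y z l δ : ℤ}
    (hδ : κ' * δ = q₁ * (γ * ρ₁ * κ' * k) + q₁ + ρ₁)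
    (h : x + y * (1 + γ * ρ₁ * κ' * k) + z * δ =
      l * (γ * q₁ * (1 + γ * ρ₁ * κ' * k) + γ * ρ₁)) :
    κ' * x + (κ' * (y - l * (γ * q₁)) + z * q₁) + z * ρ₁ =
      κ' * (γ * ρ₁) * (l - (κ' * (y - l * (γ * q₁)) + z * q₁) * k) := by
  linear_combination κ' * h - z * hδ

/-- An atom containing a zero-sum subsequence of norm 1 has norm 1 itself. Excluding those
subsequences bounds x and z, and then `weight_identity` leaves room only for l - wk = 1. -/
theorem norm_modEq_one_core {γ κ' q₁ ρ₁ β k δ x y z l : ℕ} (hγ : 0 < γ) (hκ : 0 < κ')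
    (hq : 0 < q₁) (hρ : 0 < ρ₁) (hk : 0 < k) (hβ : κ' * β = q₁ + ρ₁)
    (hδ : κ' * δ = q₁ * (γ * ρ₁ * κ' * k) + q₁ + ρ₁)
    (h : x + y * (1 + γ * ρ₁ * κ' * k) + z * δ =
      l * (γ * q₁ * (1 + γ * ρ₁ * κ' * k) + γ * ρ₁)) (hl : 0 < l)
    (hmin : ∀ x' y' z' l' : ℕ, x' ≤ x → y' ≤ y → z' ≤ z →
      x' + y' * (1 + γ * ρ₁ * κ' * k) + z' * δ =
        l' * (γ * q₁ * (1 + γ * ρ₁ * κ' * k) + γ * ρ₁) → l' = 0 ∨ l' = l) :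
    (k : ℤ) ∣ (l : ℤ) - 1 := by
  have hone : ∀ x' y' z' : ℕ, x' ≤ x → y' ≤ y → z' ≤ z →
      x' + y' * (1 + γ * ρ₁ * κ' * k) + z' * δ =
        γ * q₁ * (1 + γ * ρ₁ * κ' * k) + γ * ρ₁ → (k : ℤ) ∣ (l : ℤ) - 1 := by
    intro x' y' z' hx hy hz he
    rcases hmin x' y' z' 1 hx hy hz (by rw [he, one_mul]) with h | h
    · omega
    · rw [← h]; simp
  have hγρ : 0 < γ * ρ₁ := Nat.mul_pos hγ hρ
  have hm : γ * κ' * δ = γ * q₁ * (1 + γ * ρ₁ * κ' * k) + γ * ρ₁ := by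
    rw [mul_assoc, hδ]; ring
  by_cases hz : γ * κ' ≤ z
  · exact hone 0 0 (γ * κ') (Nat.zero_le _) (Nat.zero_le _) hz (by simpa using hm)
  push Not at hz
  by_cases hy : y < γ * q₁
  · by_cases hx : γ * q₁ * (1 + γ * ρ₁ * κ' * k) + γ * ρ₁ ≤ x + y * (1 + γ * ρ₁ * κ' * k)
    · have hya : y * (1 + γ * ρ₁ * κ' * k) ≤ γ * q₁ * (1 + γ * ρ₁ * κ' * k) :=
        Nat.mul_le_mul_right _ hy.le
      exact hone (γ * q₁ * (1 + γ * ρ₁ * κ' * k) + γ * ρ₁ - y * (1 + γ * ρ₁ * κ' * k)) y 0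
        (by omega) le_rfl (Nat.zero_le _) (by omega)
    · push Not at hx
      have hδ0 : z * δ ≤ γ * κ' * δ := Nat.mul_le_mul_right _ hz.le
      have hl2 : l < 2 := by
        by_contra hl2
        push Not at hl2
        have := Nat.mul_le_mul_right (γ * q₁ * (1 + γ * ρ₁ * κ' * k) + γ * ρ₁) hl2
        omega
      rw [show l = 1 by omega]; simp
  push Not at hy
  by_cases hx : γ * ρ₁ ≤ x
  · exact hone (γ * ρ₁) (γ * q₁) 0 hx hy (Nat.zero_le _) (by ring)
  push Not at hx
  have hid := weight_identity (γ := γ) (κ' := κ') (q₁ := q₁) (ρ₁ := ρ₁) (k := k) (x := x) (y := y)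
    (z := z) (l := l) (δ := δ) (by exact_mod_cast hδ) (by exact_mod_cast h)
  obtain ⟨w, hw⟩ : ∃ w : ℤ, w = κ' * (y - l * (γ * q₁)) + z * q₁ := ⟨_, rfl⟩
  obtain ⟨l₁, hl₁⟩ : ∃ l₁ : ℤ, l₁ = l - w * k := ⟨_, rfl⟩
  rw [← hw, ← hl₁] at hid
  have hκz : (0 : ℤ) < κ' := by exact_mod_cast hκ
  have hρz : (0 : ℤ) < ρ₁ := by exact_mod_cast hρ
  have hqz : (0 : ℤ) < q₁ := by exact_mod_cast hq
  have hγz : (0 : ℤ) < γ := by exact_mod_cast hγ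
  have hkz : (0 : ℤ) < k := by exact_mod_cast hk
  have hlz : (0 : ℤ) < l := by exact_mod_cast hl
  have hxz : (x : ℤ) + 1 ≤ γ * ρ₁ := by exact_mod_cast hx
  have hx0 : (0 : ℤ) ≤ x := by positivity
  have hz0 : (0 : ℤ) ≤ z := by positivity
  have hzz : (z : ℤ) + 1 ≤ γ * κ' := by exact_mod_cast hz
  have hzρ : (z : ℤ) * ρ₁ ≤ (γ * κ') * ρ₁ := by
    exact mul_le_mul_of_nonneg_right (by linarith) hρz.le
  have hzρ0 : (0 : ℤ) ≤ z * ρ₁ := by positivity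
  have hκx : (κ' : ℤ) * (x + 1) ≤ κ' * (γ * ρ₁) := mul_le_mul_of_nonneg_left hxz hκz.le
  have hκρ : (0 : ℤ) < κ' * (γ * ρ₁) := by positivity
  -- At this point x < γρ₁ and z < γκ', so κ'x + zρ₁ < 2κ'γρ₁.
  have hw0 : 0 ≤ w := by
    by_contra hneg
    push Not at hneg
    have h0 : w * k < 0 := mul_neg_of_neg_of_pos hneg hkz
    have h1 : 2 ≤ l₁ := by linarith
    have h2 : (κ' : ℤ) * (γ * ρ₁) * 2 ≤ κ' * (γ * ρ₁) * l₁ := mul_le_mul_of_nonneg_left h1 hκρ.le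
    linarith
  have hl1 : 1 ≤ l₁ := by
    by_contra hneg
    push Not at hneg
    have h2 : (κ' : ℤ) * (γ * ρ₁) * l₁ ≤ 0 :=
      mul_nonpos_of_nonneg_of_nonpos hκρ.le (by linarith)
    have hκx0 : (0 : ℤ) ≤ κ' * x := by positivity
    have hw1 : w = 0 := by linarith
    have : l₁ = l := by rw [hl₁, hw1]; ring
    omega
  rcases hl1.lt_or_eq with hl2 | hl2
  swap
  · exact ⟨w, by rw [← hl2] at hl₁; linarith⟩
  exfalso
  have hl2' : 2 ≤ l₁ := hl2
  have hbig : (κ' : ℤ) * (γ * ρ₁) * 2 ≤ κ' * (γ * ρ₁) * l₁ :=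
    mul_le_mul_of_nonneg_left hl2' hκρ.le
  -- If l - wk ≥ 2, there is a proper zero-sum subsequence with no e, all z copies of δe and norm 1
  -- + w'k: w' is the value that solves the identity with x = 0 and l - wk = 1.
  obtain ⟨w', hw'⟩ : ∃ w' : ℤ, w' = κ' * (γ * ρ₁) - z * ρ₁ := ⟨_, rfl⟩
  have hw'0 : 0 ≤ w' := by linarith
  have hww : w' < w := by linarith
  have hβz : (κ' : ℤ) * β = q₁ + ρ₁ := by exact_mod_cast hβ
  obtain ⟨y', hy'⟩ : ∃ y' : ℤ, y' = (1 + w' * k) * (γ * q₁) + γ * ρ₁ - z * β := ⟨_, rfl⟩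
  have hκy' : (κ' : ℤ) * y' = κ' * (1 + w' * k) * (γ * q₁) + w' - z * q₁ := by
    rw [hy', hw']; linear_combination (-(z : ℤ)) * hβz
  have hzq : (z : ℤ) * q₁ ≤ (γ * κ') * q₁ :=
    mul_le_mul_of_nonneg_right (by linarith) hqz.le
  have hwk0 : 0 ≤ w' * k := by positivity
  have hy'0 : 0 ≤ y' := by
    by_contra hneg
    push Not at hneg
    have h1 : (κ' : ℤ) * y' < 0 := mul_neg_of_pos_of_neg hκz hneg
    have h2 : (0 : ℤ) ≤ κ' * (w' * k) * (γ * q₁) := by positivity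
    linarith
  have hwk : w' * k < w * k := mul_lt_mul_of_pos_right hww hkz
  have hl3 : 1 + w' * k < l := by linarith
  have hy'y : y' ≤ y := by
    by_contra hneg
    push Not at hneg
    have h1 : (κ' : ℤ) * y < κ' * y' := mul_lt_mul_of_pos_left hneg hκz
    have h2 : (κ' : ℤ) * (1 + w' * k) * (γ * q₁) ≤ κ' * l * (γ * q₁) := by
      have h3 : (0 : ℤ) ≤ κ' * (γ * q₁) := by positivity
      have := mul_le_mul_of_nonneg_left hl3.le h3
      linarith
    linarith
  lift y' to ℕ using hy'0
  lift w' to ℕ using hw'0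
  have hzero : 0 + y' * (1 + γ * ρ₁ * κ' * k) + z * δ =
      (1 + w' * k) * (γ * q₁ * (1 + γ * ρ₁ * κ' * k) + γ * ρ₁) := by
    have hδz : (κ' : ℤ) * δ = q₁ * (γ * ρ₁ * κ' * k) + q₁ + ρ₁ := by exact_mod_cast hδ
    have : (κ' : ℤ) * (0 + y' * (1 + γ * ρ₁ * κ' * k) + z * δ) =
        κ' * ((1 + w' * k) * (γ * q₁ * (1 + γ * ρ₁ * κ' * k) + γ * ρ₁)) := by
      linear_combination (1 + (γ : ℤ) * ρ₁ * κ' * k) * hκy' + (z : ℤ) * hδz + hw'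
    have := mul_left_cancel₀ hκz.ne' this
    exact_mod_cast this
  rcases hmin 0 y' z (1 + w' * k) (Nat.zero_le _) (by exact_mod_cast hy'y) le_rfl hzero with h | h
  · omega
  · have : ((1 + w' * k : ℕ) : ℤ) = l := by exact_mod_cast h
    push_cast at this
    linarith

/-- Choose a sequence with w ≥ 1 of least norm. Since w is additive, a splitting would leave a part
with w ≥ 1 and smaller norm; so the sequence is an atom, and w ≥ 1 excludes norm 1. -/
theorem exists_norm_eq_one_add {γ κ' q₁ ρ₁ β k δ : ℕ} (hγ : 0 < γ) (hκ : 0 < κ')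
    (hq : 0 < q₁) (hρ : 0 < ρ₁) (hk : 0 < k) (hβ : κ' * β = q₁ + ρ₁) (hcop : κ'.Coprime ρ₁)
    (hδ : κ' * δ = q₁ * (γ * ρ₁ * κ' * k) + q₁ + ρ₁) :
    ∃ x y z : ℕ, x + y * (1 + γ * ρ₁ * κ' * k) + z * δ =
        (1 + k) * (γ * q₁ * (1 + γ * ρ₁ * κ' * k) + γ * ρ₁) ∧
      ∀ x' y' z' l' : ℕ, x' ≤ x → y' ≤ y → z' ≤ z →
        x' + y' * (1 + γ * ρ₁ * κ' * k) + z' * δ =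
          l' * (γ * q₁ * (1 + γ * ρ₁ * κ' * k) + γ * ρ₁) → l' = 0 ∨ l' = 1 + k := by
  have hκz : (0 : ℤ) < κ' := by exact_mod_cast hκ
  have hρz : (0 : ℤ) < ρ₁ := by exact_mod_cast hρ
  have hqz : (0 : ℤ) < q₁ := by exact_mod_cast hq
  have hγz : (1 : ℤ) ≤ γ := by exact_mod_cast hγ
  have hkz : (0 : ℤ) < k := by exact_mod_cast hk
  have hβz : (κ' : ℤ) * β = q₁ + ρ₁ := by exact_mod_cast hβ
  have hδz : (κ' : ℤ) * δ = q₁ * (γ * ρ₁ * κ' * k) + q₁ + ρ₁ := by exact_mod_cast hδ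
  have hm : 0 < γ * q₁ * (1 + γ * ρ₁ * κ' * k) + γ * ρ₁ := by positivity
  have hδ0 : 0 < δ := by
    rcases Nat.eq_zero_or_pos δ with h | h
    · rw [h] at hδ; simp at hδ; omega
    · exact h
  let P : ℕ → Prop := fun l => ∃ x y z : ℕ, x + y * (1 + γ * ρ₁ * κ' * k) + z * δ =
        l * (γ * q₁ * (1 + γ * ρ₁ * κ' * k) + γ * ρ₁) ∧
        (1 : ℤ) ≤ κ' * (y - l * (γ * q₁)) + z * q₁
  have hinit : P (1 + k) := by
    -- Solve zρ₁ ≡ -1 mod κ'; this allows w = 1 and norm exactly 1 + k, which bounds the least norm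
    -- from above.
    obtain ⟨z, hzlt, v, hv⟩ : ∃ z < κ', ∃ v : ℕ, z * ρ₁ + 1 = κ' * v := by
      obtain ⟨b, hb⟩ := Int.mod_coprime hcop.symm
      refine ⟨((-b) % κ').toNat, ?_, ?_⟩
      · have := Int.emod_lt_of_pos (-b) hκz
        have := Int.emod_nonneg (-b) hκz.ne'
        omega
      · have h0 := Int.emod_nonneg (-b) hκz.ne'
        have h1 : (κ' : ℤ) ∣ ((-b) % κ') * ρ₁ + 1 := by
          have h2 : (κ' : ℤ) ∣ 1 - ρ₁ * b := (Int.modEq_iff_dvd).1 hb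
          have h3 : (κ' : ℤ) ∣ (-b) - (-b) % κ' := Int.dvd_self_sub_emod
          have := dvd_sub h2 (h3.mul_right (ρ₁ : ℤ))
          rwa [show (1 - ρ₁ * b : ℤ) - (-b - -b % κ') * ρ₁ = (-b % κ') * ρ₁ + 1 by ring] at this
        obtain ⟨v, hv⟩ := h1
        have hv0 : 0 ≤ v := by
          by_contra hneg
          push Not at hneg
          have h5 : (κ' : ℤ) * v < 0 := mul_neg_of_pos_of_neg hκz hneg
          have h6 : 0 ≤ ((-b) % κ') * ρ₁ := mul_nonneg h0 hρz.le
          linarith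
        refine ⟨v.toNat, ?_⟩
        zify
        rw [Int.toNat_of_nonneg h0, Int.toNat_of_nonneg hv0]
        exact hv
    have hvz : (z : ℤ) * ρ₁ + 1 = κ' * v := by exact_mod_cast hv
    have hzz : (z : ℤ) + 1 ≤ κ' := by exact_mod_cast hzlt
    have hκγ : (κ' : ℤ) ≤ κ' * γ := le_mul_of_one_le_right hκz.le hγz
    have hx0 : (0 : ℤ) ≤ γ * ρ₁ - v := by
      by_contra hneg
      push Not at hneg
      have h1 : (κ' : ℤ) * (γ * ρ₁) + κ' ≤ κ' * v := by nlinarith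
      have h2 : (κ' : ℤ) * ρ₁ ≤ κ' * γ * ρ₁ := mul_le_mul_of_nonneg_right hκγ hρz.le
      have h3 : ((z : ℤ) + 1) * ρ₁ ≤ κ' * ρ₁ := mul_le_mul_of_nonneg_right hzz hρz.le
      linarith
    obtain ⟨y, hy⟩ : ∃ y : ℤ, y = (1 + k) * (γ * q₁) + v - z * β := ⟨_, rfl⟩
    have hκy : (κ' : ℤ) * y = κ' * (1 + k) * (γ * q₁) + 1 - z * q₁ := by
      rw [hy]; linear_combination -(z : ℤ) * hβz - hvz
    have hy0 : 0 ≤ y := by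
      by_contra hneg
      push Not at hneg
      have h1 : (κ' : ℤ) * y < 0 := mul_neg_of_pos_of_neg hκz hneg
      have h2 : (κ' : ℤ) * q₁ ≤ κ' * γ * q₁ := mul_le_mul_of_nonneg_right hκγ hqz.le
      have h3 : ((z : ℤ) + 1) * q₁ ≤ κ' * q₁ := mul_le_mul_of_nonneg_right hzz hqz.le
      have h4 : (0 : ℤ) ≤ κ' * k * (γ * q₁) := by positivity
      linarith
    lift y to ℕ using hy0
    obtain ⟨x, hx⟩ : ∃ x : ℤ, x = γ * ρ₁ - v := ⟨_, rfl⟩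
    rw [← hx] at hx0
    lift x to ℕ using hx0
    refine ⟨x, y, z, ?_, ?_⟩
    · have : (κ' : ℤ) * (x + y * (1 + γ * ρ₁ * κ' * k) + z * δ) =
          κ' * ((1 + k) * (γ * q₁ * (1 + γ * ρ₁ * κ' * k) + γ * ρ₁)) := by
        linear_combination (κ' : ℤ) * hx + (1 + (γ : ℤ) * ρ₁ * κ' * k) * hκy + (z : ℤ) * hδz + hvz
      have := mul_left_cancel₀ hκz.ne' this
      exact_mod_cast this
    · push_cast
      linarith
  classical
  obtain ⟨l, ⟨x, y, z, hsum, hw⟩, hlmin⟩ : ∃ l, P l ∧ ∀ l' < l, ¬ P l' :=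
    ⟨Nat.find ⟨_, hinit⟩, Nat.find_spec ⟨_, hinit⟩, fun l' h => Nat.find_min ⟨_, hinit⟩ h⟩
  have hlk : l ≤ 1 + k := by
    by_contra h
    exact hlmin _ (by omega) hinit
  have hl0 : 0 < l := by
    rcases Nat.eq_zero_or_pos l with rfl | h
    · rw [zero_mul] at hsum
      have hy : y = 0 := by
        by_contra hne
        have : 0 < y * (1 + γ * ρ₁ * κ' * k) := by positivity
        omega
      have hz : z = 0 := by
        by_contra hne
        have : 0 < z * δ := by positivity
        omega
      subst hy hz
      simp at hw
    · exact h
  have hmin : ∀ x' y' z' l' : ℕ, x' ≤ x → y' ≤ y → z' ≤ z →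
        x' + y' * (1 + γ * ρ₁ * κ' * k) + z' * δ =
          l' * (γ * q₁ * (1 + γ * ρ₁ * κ' * k) + γ * ρ₁) → l' = 0 ∨ l' = l := by
    intro x' y' z' l' hx hy hz h
    have hle : l' ≤ l := by
      refine Nat.le_of_mul_le_mul_right ?_ hm
      rw [← h, ← hsum]
      have := Nat.mul_le_mul_right (1 + γ * ρ₁ * κ' * k) hy
      have := Nat.mul_le_mul_right δ hz
      omega
    by_contra hcon
    push Not at hcon
    obtain ⟨h1, h2⟩ := hcon
    obtain ⟨x'', rfl⟩ := Nat.exists_eq_add_of_le hx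
    obtain ⟨y'', rfl⟩ := Nat.exists_eq_add_of_le hy
    obtain ⟨z'', rfl⟩ := Nat.exists_eq_add_of_le hz
    obtain ⟨l'', rfl⟩ := Nat.exists_eq_add_of_le hle
    by_cases hc : (1 : ℤ) ≤ κ' * (y' - l' * (γ * q₁)) + z' * q₁
    · exact hlmin l' (by omega) ⟨x', y', z', h, hc⟩
    · refine hlmin l'' (by omega) ⟨x'', y'', z'', ?_, ?_⟩
      · have h3 : (l' + l'') * (γ * q₁ * (1 + γ * ρ₁ * κ' * k) + γ * ρ₁) =
            l' * (γ * q₁ * (1 + γ * ρ₁ * κ' * k) + γ * ρ₁) +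
            l'' * (γ * q₁ * (1 + γ * ρ₁ * κ' * k) + γ * ρ₁) := by ring
        have h4 : (y' + y'') * (1 + γ * ρ₁ * κ' * k) =
          y' * (1 + γ * ρ₁ * κ' * k) + y'' * (1 + γ * ρ₁ * κ' * k) := by ring
        have h5 : (z' + z'') * δ = z' * δ + z'' * δ := by ring
        omega
      · push_cast at hw
        push Not at hc
        have hc' : (κ' : ℤ) * (y' - l' * (γ * q₁)) + z' * q₁ ≤ 0 := by omega
        linarith
  have hdvd := norm_modEq_one_core hγ hκ hq hρ hk hβ hδ hsum hl0 hmin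
  have hid := weight_identity (γ := γ) (κ' := κ') (q₁ := q₁) (ρ₁ := ρ₁) (k := k) (x := x) (y := y)
    (z := z) (l := l) (δ := δ) hδz (by exact_mod_cast hsum)
  have hl1 : l ≠ 1 := by
    rintro rfl
    obtain ⟨w, hwdef⟩ : ∃ w : ℤ, w = κ' * (y - (1 : ℕ) * (γ * q₁)) + z * q₁ := ⟨_, rfl⟩
    rw [← hwdef] at hid hw
    have h1 : (1 : ℤ) ≤ w * k := by nlinarith
    have h2 : (κ' : ℤ) * (γ * ρ₁) * (((1 : ℕ) : ℤ) - w * k) ≤ 0 :=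
      mul_nonpos_of_nonneg_of_nonpos (by positivity) (by push_cast; linarith)
    have h3 : (0 : ℤ) ≤ κ' * x := by positivity
    have h4 : (0 : ℤ) ≤ z * ρ₁ := by positivity
    linarith
  have : l = 1 + k := by
    have := Int.le_of_dvd (by omega) hdvd
    omega
  subst this
  exact ⟨x, y, z, hsum, hmin⟩

/-- Here γ = gcd(κ, ρ). Since κ divides both m and the lcm, it divides q + ρ, so γ divides q as
well. -/
theorem exists_reduced_parameters {q ρ κ k m : ℕ} (hq : 0 < q) (hρ : 0 < ρ) (hκ : 0 < κ)
    (hm : m = q * (1 + Nat.lcm ρ κ * k) + ρ) (hκm : κ ∣ m) :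
    ∃ γ κ' q₁ ρ₁ β δ : ℕ, 0 < γ ∧ 0 < κ' ∧ 0 < q₁ ∧ 0 < ρ₁ ∧ κ = γ * κ' ∧ q = γ * q₁ ∧
      ρ = γ * ρ₁ ∧ κ'.Coprime ρ₁ ∧ κ' * β = q₁ + ρ₁ ∧
      κ' * δ = q₁ * (γ * ρ₁ * κ' * k) + q₁ + ρ₁ ∧ Nat.lcm ρ κ = γ * ρ₁ * κ' ∧ m = κ * δ := by
  have hqρ : κ ∣ q + ρ := by
    have h1 : κ ∣ q * (Nat.lcm ρ κ * k) := ((Nat.dvd_lcm_right ρ κ).mul_right k).mul_left q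
    rw [hm, show q * (1 + Nat.lcm ρ κ * k) + ρ = q * (Nat.lcm ρ κ * k) + (q + ρ) by ring] at hκm
    exact (Nat.dvd_add_right h1).1 hκm
  obtain ⟨γ, κ', ρ₁, hγ, hcop, hκ', hρ₁⟩ : ∃ γ κ' ρ₁ : ℕ, 0 < γ ∧ κ'.Coprime ρ₁ ∧ κ = κ' * γ ∧
      ρ = ρ₁ * γ := by
    obtain ⟨g, a, b, h⟩ := Nat.exists_coprime κ ρ
    exact ⟨Nat.gcd κ ρ, g, a, Nat.gcd_pos_of_pos_left _ hκ, b, h.1, h.2⟩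
  have hγq : γ ∣ q := by
    have h1 : γ ∣ q + ρ := (Dvd.intro_left κ' hκ'.symm).trans hqρ
    exact (Nat.dvd_add_left (Dvd.intro_left ρ₁ hρ₁.symm)).1 h1
  obtain ⟨q₁, hq₁⟩ := hγq
  have hlcm : Nat.lcm ρ κ = γ * ρ₁ * κ' := by
    rw [hκ', hρ₁, Nat.lcm_mul_right, Nat.Coprime.lcm_eq_mul hcop.symm]; ring
  obtain ⟨β, hβ⟩ := hqρ
  obtain ⟨δ, hδ⟩ := hκm
  refine ⟨γ, κ', q₁, ρ₁, β, δ, hγ, Nat.pos_of_ne_zero ?_, Nat.pos_of_ne_zero ?_,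
    Nat.pos_of_ne_zero ?_, by rw [hκ', mul_comm], hq₁, by rw [hρ₁, mul_comm], hcop, ?_, ?_, hlcm,
    hδ⟩
  · rintro rfl; simp at hκ'; omega
  · rintro rfl; simp at hq₁; omega
  · rintro rfl; simp at hρ₁; omega
  · refine Nat.eq_of_mul_eq_mul_left hγ ?_
    rw [← mul_assoc, mul_comm γ κ', ← hκ', ← hβ, hq₁, hρ₁]; ring
  · refine Nat.eq_of_mul_eq_mul_left hγ ?_
    rw [← mul_assoc, mul_comm γ κ', ← hκ', ← hδ, hm, hlcm, hq₁, hρ₁]; ring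

end Arithmetic

/-! ### Sequences in three elements and the realization of k -/

section Sequences

variable {G : Type*} [AddCommGroup G]

/-- The sequence `e^x h^y f^z`. -/
def triple (e h f : G) (x y z : ℕ) : Multiset G :=
  Multiset.replicate x e + Multiset.replicate y h + Multiset.replicate z f

theorem triple_sum (e h f : G) (x y z : ℕ) :
    (triple e h f x y z).sum = x • e + y • h + z • f := by
  simp [triple]

theorem triple_map_sum {X : Type*} [AddCommMonoid X] (θ : G → X) (e h f : G) (x y z : ℕ) :
    ((triple e h f x y z).map θ).sum = x • θ e + y • θ h + z • θ f := by
  simp [triple]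

theorem exists_of_le_add {A B C : Multiset G} (h : C ≤ A + B) :
    ∃ A' ≤ A, ∃ B' ≤ B, C = A' + B' := by
  classical
  refine ⟨C ∩ A, Multiset.inter_le_right, C - A, ?_, ?_⟩
  · rw [Multiset.sub_le_iff_le_add, add_comm]; exact h
  · ext g
    simp only [Multiset.count_add, Multiset.count_inter, Multiset.count_sub]
    omega

theorem exists_of_le_triple {e h f : G} {x y z : ℕ} {B : Multiset G} (hB : B ≤ triple e h f x y z) :
    ∃ x' ≤ x, ∃ y' ≤ y, ∃ z' ≤ z, B = triple e h f x' y' z' := by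
  obtain ⟨B', hB', C, hC, rfl⟩ := exists_of_le_add hB
  obtain ⟨A, hA, D, hD, rfl⟩ := exists_of_le_add hB'
  obtain ⟨x', hx, rfl⟩ := Multiset.le_replicate_iff.1 hA
  obtain ⟨y', hy, rfl⟩ := Multiset.le_replicate_iff.1 hD
  obtain ⟨z', hz, rfl⟩ := Multiset.le_replicate_iff.1 hC
  exact ⟨x', hx, y', hy, z', hz, rfl⟩

theorem exists_eq_triple {e h f : G} {A : Multiset G} (hA : ∀ g ∈ A, g = e ∨ g = h ∨ g = f) :
    ∃ x y z, A = triple e h f x y z := by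
  induction A using Multiset.induction_on with
  | empty => exact ⟨0, 0, 0, rfl⟩
  | cons g s ih =>
    obtain ⟨x, y, z, rfl⟩ := ih fun g hg => hA g (Multiset.mem_cons_of_mem hg)
    rcases hA g (Multiset.mem_cons_self _ _) with rfl | rfl | rfl
    · exact ⟨x + 1, y, z, by simp [triple, Multiset.replicate_succ]⟩
    · exact ⟨x, y + 1, z, by simp [triple, Multiset.replicate_succ]⟩
    · exact ⟨x, y, z + 1, by simp [triple, Multiset.replicate_succ]⟩

theorem triple_le_triple {e h f : G} {x y z x' y' z' : ℕ} (hx : x' ≤ x) (hy : y' ≤ y)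
    (hz : z' ≤ z) : triple e h f x' y' z' ≤ triple e h f x y z :=
  add_le_add (add_le_add (Multiset.replicate_le_replicate _ |>.2 hx)
    (Multiset.replicate_le_replicate _ |>.2 hy)) (Multiset.replicate_le_replicate _ |>.2 hz)

theorem minZeroSum_triple {G₀ : Set G} {e h f : G} {x y z : ℕ} (he : e ∈ G₀) (hh : h ∈ G₀)
    (hf : f ∈ G₀) (h0 : 0 < x + y + z) (hsum : x • e + y • h + z • f = 0)
    (hmin : ∀ x' y' z' : ℕ, x' ≤ x → y' ≤ y → z' ≤ z → x' • e + y' • h + z' • f = 0 →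
      (x' = 0 ∧ y' = 0 ∧ z' = 0) ∨ (x' = x ∧ y' = y ∧ z' = z)) :
    MinZeroSum G₀ (triple e h f x y z) := by
  refine ⟨?_, by rw [triple_sum, hsum], ?_, ?_⟩
  · rw [Ne, ← Multiset.card_eq_zero]
    simp [triple]
    omega
  · intro g hg
    simp only [triple, Multiset.mem_add, Multiset.mem_replicate] at hg
    rcases hg with (⟨-, rfl⟩ | ⟨-, rfl⟩) | ⟨-, rfl⟩ <;> assumption
  · intro B hB hB0
    obtain ⟨x', hx, y', hy, z', hz, rfl⟩ := exists_of_le_triple hB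
    rw [triple_sum] at hB0
    rcases hmin x' y' z' hx hy hz hB0 with ⟨rfl, rfl, rfl⟩ | ⟨rfl, rfl, rfl⟩
    · left; rfl
    · right; rfl

theorem minZeroSum_replicate {G₀ : Set G} {g : G} (hg : g ∈ G₀) (h0 : 0 < addOrderOf g) :
    MinZeroSum G₀ (Multiset.replicate (addOrderOf g) g) := by
  have := minZeroSum_triple (x := addOrderOf g) (y := 0) (z := 0) hg hg hg (by omega)
    (by simp [addOrderOf_nsmul_eq_zero]) (by
      intro x' y' z' hx hy hz h
      obtain rfl : y' = 0 := by omega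
      obtain rfl : z' = 0 := by omega
      simp only [zero_nsmul, add_zero] at h
      have := addOrderOf_dvd_of_nsmul_eq_zero h
      rcases Nat.eq_zero_or_pos x' with h | h
      · exact Or.inl ⟨h, rfl, rfl⟩
      · exact Or.inr ⟨le_antisymm hx (Nat.le_of_dvd h this), rfl, rfl⟩)
  simpa [triple] using this

theorem minZeroSum_complement {G₀ : Set G} {e : G} {a : ℕ} (he : e ∈ G₀) (hae : a • e ∈ G₀)
    (ha : 0 < a) (ham : a ≤ addOrderOf e) :
    MinZeroSum G₀ (triple e (a • e) e (addOrderOf e - a) 1 0) := by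
  refine minZeroSum_triple he hae he (by omega) ?_ ?_
  · rw [one_nsmul, zero_nsmul, add_zero, ← add_nsmul, Nat.sub_add_cancel ham,
      addOrderOf_nsmul_eq_zero]
  · intro x' y' z' hx hy hz h
    obtain rfl : z' = 0 := by omega
    rw [zero_nsmul, add_zero, ← mul_nsmul', ← add_nsmul] at h
    have hd := addOrderOf_dvd_of_nsmul_eq_zero h
    rcases Nat.eq_zero_or_pos y' with rfl | hy'
    · left
      rw [zero_mul, add_zero] at hd
      exact ⟨Nat.eq_zero_of_dvd_of_lt hd (by omega), rfl, rfl⟩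
    · obtain rfl : y' = 1 := by omega
      right
      have := Nat.le_of_dvd (by omega) hd
      omega

theorem LengthsCongr.mono {G₀ G₁ : Set G} {d : ℕ} (h : LengthsCongr G₁ d) (hG : G₀ ⊆ G₁) :
    LengthsCongr G₀ d := by
  have key : ∀ A, MinZeroSum G₀ A → MinZeroSum G₁ A := fun A hA =>
    ⟨hA.ne_zero, hA.sum_eq, fun g hg => hG (hA.mem g hg), hA.minimal⟩
  exact fun z z' hz hz' => h z z' (fun A hA => key A (hz A hA)) fun A hA => key A (hz' A hA)

/-- The norm of a product depends only on the product, and it is congruent modulo d to the number of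
atoms in any factorization. -/
theorem lengthsCongr_of_norm {G₀ : Set G} {d m : ℕ} (hm : 0 < m) (N : G → ℕ)
    (hN : ∀ A, MinZeroSum G₀ A → ∃ l : ℕ, (A.map N).sum = l * m ∧ (d : ℤ) ∣ (l : ℤ) - 1) :
    LengthsCongr G₀ d := by
  have key : ∀ z : Multiset (Multiset G), (∀ A ∈ z, MinZeroSum G₀ A) →
      ∃ l : ℕ, (z.sum.map N).sum = l * m ∧ (d : ℤ) ∣ (l : ℤ) - Multiset.card z := by
    intro z
    induction z using Multiset.induction_on with
    | empty => exact fun _ => ⟨0, by simp, by simp⟩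
    | cons A s ih =>
      intro hz
      obtain ⟨l, h1, h2⟩ := ih fun B hB => hz B (Multiset.mem_cons_of_mem hB)
      obtain ⟨l', h3, h4⟩ := hN A (hz A (Multiset.mem_cons_self _ _))
      refine ⟨l + l', ?_, ?_⟩
      · rw [Multiset.sum_cons, Multiset.map_add, Multiset.sum_add, h1, h3]; ring
      · have := dvd_add h2 h4
        rw [Multiset.card_cons]
        push_cast
        rwa [show (l + l' - (Multiset.card s + 1) : ℤ) =
          l - Multiset.card s + (l' - 1) by ring]
  intro z z' hz hz' h
  obtain ⟨l, h1, h2⟩ := key z hz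
  obtain ⟨l', h3, h4⟩ := key z' hz'
  rw [h, h3] at h1
  obtain rfl := Nat.eq_of_mul_eq_mul_right hm h1
  have := dvd_sub h4 h2
  rwa [show (l' - Multiset.card z' - (l' - Multiset.card z) : ℤ) =
    Multiset.card z - Multiset.card z' by ring] at this

theorem eq_of_nsmul_eq_nsmul {e : G} {k k' : ℕ} (hk : 0 < k) (hkm : k ≤ addOrderOf e)
    (hk' : 0 < k') (hkm' : k' ≤ addOrderOf e) (h : k • e = k' • e) : k = k' := by
  wlog hle : k ≤ k' generalizing k k'
  · exact (this hk' hkm' hk hkm h.symm (by omega)).symm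
  obtain ⟨d, rfl⟩ := Nat.exists_eq_add_of_le hle
  rw [add_nsmul, left_eq_add] at h
  have := Nat.eq_zero_of_dvd_of_lt (addOrderOf_dvd_of_nsmul_eq_zero h) (by omega)
  omega

theorem exists_representative (e : G) : ∃ r : G → ℕ, ∀ k : ℕ, 0 < k → k ≤ addOrderOf e →
    r (k • e) = k := by
  classical
  refine ⟨fun g => if h : ∃ k : ℕ, 0 < k ∧ k ≤ addOrderOf e ∧ k • e = g then h.choose else 0,
    fun k hk hkm => ?_⟩
  have hex : ∃ k' : ℕ, 0 < k' ∧ k' ≤ addOrderOf e ∧ k' • e = k • e := ⟨k, hk, hkm, rfl⟩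
  simp only [hex, dif_pos]
  have hs := hex.choose_spec
  exact eq_of_nsmul_eq_nsmul hs.1 hs.2.1 hk hkm hs.2.2

theorem lengthsCongr_triple {e : G} {q ρ κ k m : ℕ} (hq : 0 < q) (hρ : 0 < ρ) (hκ : 0 < κ)
    (hk : 0 < k) (he : addOrderOf e = m) (hm : m = q * (1 + Nat.lcm ρ κ * k) + ρ) (hκm : κ ∣ m) :
    LengthsCongr {g | g = 0 ∨ g = e ∨ g = (1 + Nat.lcm ρ κ * k) • e ∨ g = (m / κ) • e} k := by
  obtain ⟨γ, κ', q₁, ρ₁, β, δ, hγ, hκ', hq₁, hρ₁, rfl, rfl, rfl, hcop, hβ, hδ, hlcm, hmδ⟩ :=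
    exists_reduced_parameters hq hρ hκ hm hκm
  rw [hlcm] at hm
  have hδm : m / (γ * κ') = δ := by rw [hmδ, Nat.mul_div_cancel_left _ hκ]
  rw [hδm, hlcm]
  have hm0 : 0 < m := by rw [hm]; positivity
  have hδ0 : 0 < δ := Nat.pos_of_ne_zero fun h => by rw [h] at hmδ; omega
  have hδle : δ ≤ m := by rw [hmδ]; exact Nat.le_mul_of_pos_left _ hκ
  have hale : 1 + γ * ρ₁ * κ' * k ≤ m := by
    have : 1 * (1 + γ * ρ₁ * κ' * k) ≤ γ * q₁ * (1 + γ * ρ₁ * κ' * k) :=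
      Nat.mul_le_mul_right _ hq
    omega
  obtain ⟨r, hr⟩ := exists_representative e
  rw [he] at hr
  refine lengthsCongr_of_norm hm0 r fun A hA => ?_
  -- The atom 0 has norm 1 because the representative of 0 is m, not 0.
  by_cases h0 : (0 : G) ∈ A
  · rcases hA.minimal {0} (Multiset.singleton_le.2 h0) (by simp) with h | h
    · simp at h
    · refine ⟨1, ?_, by simp⟩
      have : r 0 = m := by
        rw [← hr m hm0 le_rfl, ← he, addOrderOf_nsmul_eq_zero]
      simp [← h, this]
  · obtain ⟨x, y, z, rfl⟩ : ∃ x y z, A = triple e ((1 + γ * ρ₁ * κ' * k) • e) (δ • e) x y z := by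
      refine exists_eq_triple fun g hg => ?_
      rcases hA.mem g hg with rfl | h
      · exact absurd hg h0
      · exact h
    have hre : r e = 1 := by simpa using hr 1 one_pos hm0
    have hsum := hA.sum_eq
    rw [triple_sum, ← mul_nsmul', ← mul_nsmul', ← add_nsmul, ← add_nsmul,
      ← addOrderOf_dvd_iff_nsmul_eq_zero, he] at hsum
    obtain ⟨l, hl⟩ := hsum
    rw [mul_comm m l] at hl
    have hne := hA.ne_zero
    rw [Ne, ← Multiset.card_eq_zero] at hne
    simp only [triple, Multiset.card_add, Multiset.card_replicate] at hne
    refine ⟨l, ?_, ?_⟩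
    · rw [triple_map_sum, hre, hr _ (by omega) hale, hr _ hδ0 hδle]
      simpa using hl
    have hl0 : 0 < l := by
      refine Nat.pos_of_ne_zero fun h => ?_
      rw [h, zero_mul] at hl
      have h1 : x = 0 := by omega
      have h2 : y * (1 + γ * ρ₁ * κ' * k) = 0 := by omega
      have h3 : z * δ = 0 := by omega
      rw [mul_eq_zero] at h2 h3
      omega
    rw [hm] at hl
    refine norm_modEq_one_core hγ hκ' hq₁ hρ₁ hk hβ hδ hl hl0 fun x' y' z' l' hx hy hz h => ?_
    rw [← hm] at h
    rcases hA.minimal _ (triple_le_triple hx hy hz) (by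
      rw [triple_sum, ← mul_nsmul', ← mul_nsmul', ← add_nsmul, ← add_nsmul,
        ← addOrderOf_dvd_iff_nsmul_eq_zero, he, h]
      exact Dvd.intro_left _ rfl) with hB | hB
    · left
      rw [← Multiset.card_eq_zero] at hB
      simp only [triple, Multiset.card_add, Multiset.card_replicate] at hB
      obtain rfl : x' = 0 := by omega
      obtain rfl : y' = 0 := by omega
      obtain rfl : z' = 0 := by omega
      simp at h
      omega
    · right
      have hc := congrArg Multiset.card hB
      simp only [triple, Multiset.card_add, Multiset.card_replicate] at hc
      obtain rfl : x' = x := by omega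
      obtain rfl : y' = y := by omega
      obtain rfl : z' = z := by omega
      rw [← hm] at hl
      rw [h] at hl
      exact Nat.eq_of_mul_eq_mul_right hm0 hl

theorem isLengthGenerator_triple {e : G} {q ρ κ k m : ℕ} (hq : 0 < q) (hρ : 0 < ρ) (hκ : 0 < κ)
    (hk : 0 < k) (he : addOrderOf e = m) (hm : m = q * (1 + Nat.lcm ρ κ * k) + ρ) (hκm : κ ∣ m) :
    IsLengthGenerator {g | g = e ∨ g = (1 + Nat.lcm ρ κ * k) • e ∨ g = (m / κ) • e} k := by
  refine ⟨hk, (lengthsCongr_triple hq hρ hκ hk he hm hκm).mono fun g hg => Or.inr hg, ?_⟩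
  obtain ⟨γ, κ', q₁, ρ₁, β, δ, hγ, hκ', hq₁, hρ₁, rfl, rfl, rfl, hcop, hβ, hδ, hlcm, hmδ⟩ :=
    exists_reduced_parameters hq hρ hκ hm hκm
  rw [hlcm] at hm
  have hδm : m / (γ * κ') = δ := by rw [hmδ, Nat.mul_div_cancel_left _ hκ]
  rw [hδm, hlcm]
  obtain ⟨a, ha⟩ : ∃ a, a = 1 + γ * ρ₁ * κ' * k := ⟨_, rfl⟩
  obtain ⟨x, y, z, hsum, hmin⟩ := exists_norm_eq_one_add hγ hκ' hq₁ hρ₁ hk hβ hcop hδ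
  rw [← hm] at hsum hmin
  rw [← ha] at hsum hmin hm ⊢
  have hm0 : 0 < m := by rw [hm]; positivity
  have ha0 : 0 < a := by omega
  have hδ0 : 0 < δ := Nat.pos_of_ne_zero fun h => by rw [h] at hmδ; omega
  have hδle : δ ≤ m := by rw [hmδ]; exact Nat.le_mul_of_pos_left _ hκ
  have hale : a ≤ m := by
    have : 1 * a ≤ γ * q₁ * a := Nat.mul_le_mul_right _ hq
    omega
  obtain ⟨G₀, hG₀⟩ : ∃ G₀ : Set G, G₀ = {g | g = e ∨ g = a • e ∨ g = δ • e} := ⟨_, rfl⟩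
  rw [← hG₀]
  have heG : e ∈ G₀ := by rw [hG₀]; exact Or.inl rfl
  have haG : a • e ∈ G₀ := by rw [hG₀]; exact Or.inr (Or.inl rfl)
  have hδG : δ • e ∈ G₀ := by rw [hG₀]; exact Or.inr (Or.inr rfl)
  have hA : MinZeroSum G₀ (triple e (a • e) (δ • e) x y z) := by
    refine minZeroSum_triple heG haG hδG ?_ ?_ ?_
    · by_contra hcon
      obtain rfl : x = 0 := by omega
      obtain rfl : y = 0 := by omega
      obtain rfl : z = 0 := by omega
      have : 0 < (1 + k) * m := by positivity
      omega
    · rw [← mul_nsmul', ← mul_nsmul', ← add_nsmul, ← add_nsmul,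
        ← addOrderOf_dvd_iff_nsmul_eq_zero, he, hsum]
      exact Dvd.intro_left _ rfl
    · intro x' y' z' hx hy hz h
      rw [← mul_nsmul', ← mul_nsmul', ← add_nsmul, ← add_nsmul,
        ← addOrderOf_dvd_iff_nsmul_eq_zero, he] at h
      obtain ⟨l', hl'⟩ := h
      rw [mul_comm m l'] at hl'
      have hya := Nat.mul_le_mul_right a hy
      have hzδ := Nat.mul_le_mul_right δ hz
      rcases hmin x' y' z' l' hx hy hz hl' with rfl | rfl
      · left
        have h1 : x' = 0 := by omega
        have h2 : y' * a = 0 := by omega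
        have h3 : z' * δ = 0 := by omega
        rw [mul_eq_zero] at h2 h3
        omega
      · right
        rw [← hsum] at hl'
        exact ⟨by omega, Nat.eq_of_mul_eq_mul_right ha0 (by omega),
          Nat.eq_of_mul_eq_mul_right hδ0 (by omega)⟩
  have hUa := minZeroSum_complement heG haG ha0 (by omega)
  have hUδ := minZeroSum_complement heG hδG hδ0 (by omega)
  have hU := minZeroSum_replicate heG (by omega)
  rw [he] at hUa hUδ hU
  -- With U = e^m and A the atom of norm 1 + k: A·U^(y+z) also equals U^(1+k) times y atoms
  -- (ae)e^(m-a) and z atoms (δe)e^(m-δ). The lengths differ by k.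
  refine ⟨Multiset.replicate y (triple e (a • e) e (m - a) 1 0) +
      Multiset.replicate z (triple e (δ • e) e (m - δ) 1 0) +
      Multiset.replicate (1 + k) (Multiset.replicate m e),
    triple e (a • e) (δ • e) x y z ::ₘ Multiset.replicate (y + z) (Multiset.replicate m e),
    ?_, ?_, ?_, ?_⟩
  · intro A hA
    simp only [Multiset.mem_add, Multiset.mem_replicate] at hA
    rcases hA with (⟨-, rfl⟩ | ⟨-, rfl⟩) | ⟨-, rfl⟩ <;> assumption
  · intro A hA'
    simp only [Multiset.mem_cons, Multiset.mem_replicate] at hA'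
    rcases hA' with rfl | ⟨-, rfl⟩ <;> assumption
  · have hrep : ∀ s t (g : G), s • Multiset.replicate t g = Multiset.replicate (s * t) g := by
      intro s t g
      rw [← Multiset.nsmul_singleton, ← mul_nsmul', Multiset.nsmul_singleton]
    have hexp : y * (m - a) + z * (m - δ) + (1 + k) * m = x + (y + z) * m := by
      have h1 : y * (m - a) + y * a = y * m := by
        rw [← mul_add, Nat.sub_add_cancel hale]
      have h2 : z * (m - δ) + z * δ = z * m := by
        rw [← mul_add, Nat.sub_add_cancel hδle]
      rw [add_mul y z m]
      omega
    simp only [Multiset.sum_add, Multiset.sum_replicate, Multiset.sum_cons, triple,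
      nsmul_add, hrep, mul_one, Multiset.replicate_zero, add_zero]
    have h3 : Multiset.replicate (y * (m - a)) e + Multiset.replicate (z * (m - δ)) e +
        Multiset.replicate ((1 + k) * m) e =
        Multiset.replicate x e + Multiset.replicate ((y + z) * m) e := by
      rw [← Multiset.replicate_add, ← Multiset.replicate_add, hexp, Multiset.replicate_add]
    have := congrArg (· + (Multiset.replicate y (a • e) + Multiset.replicate z (δ • e))) h3
    rw [show Multiset.replicate (y * (m - a)) e + Multiset.replicate y (a • e) +
      (Multiset.replicate (z * (m - δ)) e + Multiset.replicate z (δ • e)) +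
      Multiset.replicate ((1 + k) * m) e = Multiset.replicate (y * (m - a)) e +
        Multiset.replicate (z * (m - δ)) e + Multiset.replicate ((1 + k) * m) e +
        (Multiset.replicate y (a • e) + Multiset.replicate z (δ • e)) by abel, this]
    abel
  · simp
    ring

end Sequences

/-! ### Arithmetic description of I(m) and the inclusion ⊇ -/

section GcdSet

theorem eq_lcm_mul_gcd {a b c κ : ℕ} (ha : 0 < a) (h : a * c = b * κ) :
    a * c = Nat.lcm c κ * Nat.gcd a b := by
  obtain ⟨g, a', b', hg, hcop, h1, h2⟩ :=
    Nat.exists_coprime' (m := a) (n := b) (Nat.gcd_pos_of_pos_left _ ha)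
  have h3 : a' * c = b' * κ := by
    refine Nat.eq_of_mul_eq_mul_left hg ?_
    rw [← mul_assoc, ← mul_assoc, mul_comm g, mul_comm g, ← h1, ← h2, h]
  obtain ⟨s, rfl⟩ : a' ∣ κ := hcop.dvd_of_dvd_mul_left (Dvd.intro _ h3)
  have ha' : 0 < a' := Nat.pos_of_ne_zero fun h => by rw [h] at h1; omega
  have hc : c = b' * s := Nat.eq_of_mul_eq_mul_left ha' (by rw [h3]; ring)
  rw [hc, Nat.lcm_mul_right, Nat.Coprime.lcm_eq_mul hcop.symm, h1, h2, Nat.gcd_mul_right,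
    hcop.gcd_eq_one]
  ring

/-- The dictionary is ρ = c₁, q = c₂, κ = m/d. The two fractions a, b then satisfy a·c₁ = b·κ,
whence a·c₁ = lcm(c₁, κ)·gcd(a, b), while m = c₂(1 + a·c₁) + c₁. -/
theorem mem_gcdSet_iff {m k : ℕ} :
    k ∈ gcdSet m ↔ ∃ q ρ κ : ℕ, 0 < q ∧ 0 < ρ ∧ 0 < κ ∧ 0 < k ∧ κ ∣ m ∧
      m = q * (1 + Nat.lcm ρ κ * k) + ρ := by
  constructor
  · rintro ⟨c₁, c₂, d, ⟨h1, h1m, h2, h2m, hd, hdm, ⟨a', ha'0, ha'⟩, -⟩, a, b, ha, hb, rfl⟩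
    simp only at h1 h1m h2 h2m hd hdm ha'
    obtain ⟨κ, rfl⟩ := hdm
    have ha0 : 0 < a := by
      have : (a' : ℚ) = a := ha'.trans ha.symm
      have : a' = a := by exact_mod_cast this
      omega
    have hκ : 0 < κ := Nat.pos_of_ne_zero fun h => by rw [h] at h1m; omega
    have hc₁ : (c₁ : ℚ) ≠ 0 := by positivity
    have hc₂ : (c₂ : ℚ) ≠ 0 := by positivity
    have hd0 : (d : ℚ) ≠ 0 := by positivity
    have hκ0 : (κ : ℚ) ≠ 0 := by positivity
    rw [frac₁, eq_div_iff (by positivity)] at ha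
    rw [frac₂, eq_div_iff (by positivity)] at hb
    push_cast at ha hb
    have hab : a * c₁ = b * κ := by
      have h3 : (a * c₁ : ℚ) = b * κ := by
        refine mul_right_cancel₀ (mul_ne_zero hc₂ hd0) ?_
        linear_combination d * ha - hb
      exact_mod_cast h3
    refine ⟨c₂, c₁, κ, h2, h1, hκ, Nat.gcd_pos_of_pos_left _ ha0, Dvd.intro_left _ rfl, ?_⟩
    rw [← eq_lcm_mul_gcd ha0 hab]
    have h3 : ((d * κ : ℕ) : ℚ) = ((c₂ * (1 + a * c₁) + c₁ : ℕ) : ℚ) := by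
      push_cast
      linear_combination -ha
    exact_mod_cast h3
  · rintro ⟨q, ρ, κ, hq, hρ, hκ, hk, ⟨d, hd⟩, hm⟩
    obtain ⟨a, ha⟩ := Nat.dvd_lcm_left ρ κ
    obtain ⟨b, hb⟩ := Nat.dvd_lcm_right ρ κ
    have hlcm : 0 < Nat.lcm ρ κ := Nat.lcm_pos hρ hκ
    have hm0 : 0 < m := by omega
    have hd0 : 0 < d := Nat.pos_of_ne_zero fun h => by rw [h] at hd; omega
    have ha0 : 0 < a := Nat.pos_of_ne_zero fun h => by rw [h] at ha; omega
    have hb0 : 0 < b := Nat.pos_of_ne_zero fun h => by rw [h] at hb; omega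
    have hρ0 : (ρ : ℚ) ≠ 0 := by positivity
    have hq0 : (q : ℚ) ≠ 0 := by positivity
    have hmQ : (m : ℚ) = q * (1 + ρ * a * k) + ρ := by
      rw [hm, ha]; push_cast; ring
    have hab : (ρ * a : ℚ) = κ * b := by exact_mod_cast ha.symm.trans hb
    have hmd : (m : ℚ) = κ * d := by exact_mod_cast hd
    have hm0' : (m : ℚ) ≠ 0 := by positivity
    have f1 : ((a * k : ℕ) : ℚ) = frac₁ m ρ q := by
      rw [frac₁, eq_div_iff (by positivity)]
      push_cast
      linear_combination -hmQ
    have f2 : ((b * k : ℕ) : ℚ) = frac₂ m ρ q d := by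
      rw [frac₂, eq_div_iff (by positivity)]
      push_cast
      linear_combination (b * k * q : ℚ) * hmd - (d : ℚ) * hmQ - (q * k * d : ℚ) * hab
    have hqm : q ≤ m := by
      have : q * 1 ≤ q * (1 + Nat.lcm ρ κ * k) := Nat.mul_le_mul_left _ (by omega)
      omega
    refine ⟨ρ, q, d, ⟨hρ, by simp only; omega, hq, hqm, hd0, Dvd.intro_left _ hd.symm,
      ⟨a * k, by positivity, f1⟩, ⟨b * k, by positivity, f2⟩⟩, a * k, b * k, f1, f2, ?_⟩
    have h3 := eq_lcm_mul_gcd (a := a) (b := b) (c := ρ) (κ := κ) ha0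
      (by rw [mul_comm, ← ha, hb, mul_comm])
    have h4 : Nat.gcd a b = 1 := by
      rw [mul_comm, ← ha] at h3
      exact (Nat.eq_of_mul_eq_mul_left hlcm (by rw [← h3, mul_one]))
    rw [Nat.gcd_mul_right, h4, one_mul]

theorem gcdSet_subset_groupMinimalDistances {G : Type*} [AddCommGroup G] [Finite G]
    [IsAddCyclic G] {m k : ℕ} (hm : m ∣ Nat.card G) (hk : k ∈ gcdSet m) :
    k ∈ groupMinimalDistances G := by
  obtain ⟨q, ρ, κ, hq, hρ, hκ, hk0, hκm, h⟩ := mem_gcdSet_iff.1 hk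
  obtain ⟨g, hg⟩ := IsAddCyclic.exists_generator (α := G)
  have hgo : addOrderOf g = Nat.card G := addOrderOf_eq_card_of_forall_mem_zmultiples hg
  obtain ⟨s, hs⟩ := hm
  have hcard : 0 < Nat.card G := Nat.card_pos
  have hs0 : 0 < s := Nat.pos_of_ne_zero fun h => by rw [h] at hs; omega
  have hm0 : 0 < m := by omega
  have he : addOrderOf (s • g) = m := by
    rw [addOrderOf_nsmul_of_dvd hs0.ne' (by rw [hgo, hs]; exact Dvd.intro_left _ rfl), hgo, hs,
      Nat.mul_div_cancel _ hs0]
  exact mem_groupMinimalDistances_iff.2 ⟨_, isLengthGenerator_triple hq hρ hκ hk0 he h hκm⟩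

end GcdSet

/-! ### Length weights and the structure of pairs of elements -/

section Weights

universe v

variable {G : Type v} [AddCommGroup G]

/-- A weight function on `G` with values in an abelian group `X`, for which all minimal zero-sum
sequences over `G₀` have the same weight `u`, where multiples of `u` are non-zero unless the factor
is divisible by `D`. -/
structure IsLengthWeight (G₀ : Set G) (D : ℕ) {X : Type v} [AddCommGroup X] (θ : G → X) (u : X) :
    Prop where
  map_sum : ∀ A, MinZeroSum G₀ A → (A.map θ).sum = u
  dvd : ∀ k : ℤ, k • u = 0 → (D : ℤ) ∣ k

/-- The multiplicities of the terms of a sequence, as integers. -/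
noncomputable def multiplicities (G : Type v) : Multiset G →+ (G →₀ ℤ) :=
  Multiset.sumAddMonoidHom.comp (Multiset.mapAddMonoidHom fun g => Finsupp.single g (1 : ℤ))

theorem multiplicities_injective : Function.Injective (multiplicities G) := by
  classical
  have key : ∀ (A : Multiset G) (g : G), multiplicities G A g = (A.count g : ℤ) := by
    intro A g
    induction A using Multiset.induction_on with
    | empty => simp
    | cons a s ih =>
      rw [← Multiset.singleton_add, map_add, Finsupp.add_apply, ih, Multiset.count_add]
      simp [multiplicities, Finsupp.single_apply, Multiset.count_singleton, eq_comm]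
  intro A B h
  ext g
  have := key A g
  rw [h, key B g] at this
  exact_mod_cast this.symm

/-- The relations between sequences that have factorizations over `G₀` of equal length. -/
def equalLengthRelations (G₀ : Set G) : AddSubgroup (G →₀ ℤ) where
  carrier := {t | ∃ z z' : Multiset (Multiset G), (∀ A ∈ z, MinZeroSum G₀ A) ∧
    (∀ A ∈ z', MinZeroSum G₀ A) ∧ Multiset.card z = Multiset.card z' ∧
    t = multiplicities G z.sum - multiplicities G z'.sum}
  zero_mem' := ⟨0, 0, by simp, by simp, rfl, by simp⟩
  add_mem' := by
    rintro s t ⟨z, z', hz, hz', h, rfl⟩ ⟨w, w', hw, hw', k, rfl⟩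
    refine ⟨z + w, z' + w', ?_, ?_, by simp [h, k], ?_⟩
    · intro A hA
      exact (Multiset.mem_add.1 hA).elim (hz A) (hw A)
    · intro A hA
      exact (Multiset.mem_add.1 hA).elim (hz' A) (hw' A)
    · simp only [Multiset.sum_add, map_add]
      abel
  neg_mem' := by
    rintro t ⟨z, z', hz, hz', h, rfl⟩
    exact ⟨z', z, hz', hz, h.symm, by abel⟩

/-- Take the free abelian group on G modulo `equalLengthRelations`. If ku = 0 with k ≥ 0, then k
copies of an atom times z' equal z as sequences, with |z| = |z'|; thus k is a length difference. -/
theorem IsLengthGenerator.exists_isLengthWeight {G₀ : Set G} {D : ℕ}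
    (h : IsLengthGenerator G₀ D) :
    ∃ (X : Type v) (_ : AddCommGroup X) (θ : G → X) (u : X), IsLengthWeight G₀ D θ u := by
  obtain ⟨A₀, hA₀⟩ : ∃ A₀, MinZeroSum G₀ A₀ := by
    obtain ⟨z, z', hz, hz', -, hc⟩ := h.attained
    have hp := h.pos
    obtain ⟨A, hA⟩ := Multiset.card_pos_iff_exists_mem.1 (show 0 < Multiset.card z by omega)
    exact ⟨A, hz A hA⟩
  let π := QuotientAddGroup.mk' (equalLengthRelations G₀)
  have hker : ∀ t, π t = 0 ↔ t ∈ equalLengthRelations G₀ := fun t =>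
    QuotientAddGroup.eq_zero_iff t
  refine ⟨(G →₀ ℤ) ⧸ equalLengthRelations G₀, inferInstance,
    fun g => π (Finsupp.single g 1), π (multiplicities G A₀), ?_, ?_⟩
  · intro A hA
    have h1 : (A.map fun g => π (Finsupp.single g 1)).sum = π (multiplicities G A) := by
      simp [multiplicities, map_multiset_sum]
    rw [h1, ← sub_eq_zero, ← map_sub, hker]
    exact ⟨{A}, {A₀}, by simpa using hA, by simpa using hA₀, rfl, by simp⟩
  · intro k
    have hnat : ∀ k : ℕ, k • π (multiplicities G A₀) = 0 → (D : ℤ) ∣ k := by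
      intro k hk
      rw [← map_nsmul, hker] at hk
      obtain ⟨z, z', hz, hz', hc, ht⟩ := hk
      have heq : (Multiset.replicate k A₀ + z').sum = z.sum := by
        refine multiplicities_injective ?_
        rw [Multiset.sum_add, Multiset.sum_replicate, map_add, map_nsmul, ht]
        abel
      have := h.congr _ _ (fun A hA => ?_) hz heq
      · rw [Multiset.card_add, Multiset.card_replicate, hc] at this
        push_cast at this
        simpa using this
      · rcases Multiset.mem_add.1 hA with hA | hA
        · rw [Multiset.eq_of_mem_replicate hA]; exact hA₀
        · exact hz' A hA
    intro hk
    rcases Int.natAbs_eq k with h | h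
    · rw [h]
      rw [h, natCast_zsmul] at hk
      exact hnat _ hk
    · rw [h, Int.dvd_neg]
      rw [h, neg_zsmul, natCast_zsmul, neg_eq_zero] at hk
      exact hnat _ hk

variable {G₀ : Set G} {D : ℕ} {X : Type v} [AddCommGroup X] {θ : G → X} {u : X}

theorem IsLengthWeight.dvd_sub_one (W : IsLengthWeight G₀ D θ u) {A : Multiset G}
    (hA : MinZeroSum G₀ A) {l : ℤ} (h : (A.map θ).sum = l • u) : (D : ℤ) ∣ l - 1 := by
  refine W.dvd _ ?_
  rw [sub_zsmul, ← h, W.map_sum A hA, one_zsmul, add_neg_cancel]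

theorem IsLengthWeight.order_nsmul (W : IsLengthWeight G₀ D θ u) {g : G} (hg : g ∈ G₀)
    (h0 : 0 < addOrderOf g) : addOrderOf g • θ g = u := by
  simpa using W.map_sum _ (minZeroSum_replicate hg h0)

theorem exists_nsmul_eq_of_addOrderOf_eq [Finite G] [IsAddCyclic G] {a b : G}
    (h : addOrderOf a = addOrderOf b) :
    ∃ α, 0 < α ∧ α ≤ addOrderOf a ∧ α.Coprime (addOrderOf a) ∧ b = α • a := by
  classical
  have := Fintype.ofFinite G
  have hN : 0 < addOrderOf a := addOrderOf_pos a
  have hsub : (Finset.range (addOrderOf a)).image (fun k => k • a) ⊆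
      Finset.univ.filter fun x : G => addOrderOf a • x = 0 := by
    intro x hx
    obtain ⟨k, -, rfl⟩ := Finset.mem_image.1 hx
    rw [Finset.mem_filter, nsmul_left_comm, addOrderOf_nsmul_eq_zero, nsmul_zero]
    exact ⟨Finset.mem_univ _, rfl⟩
  have hcard : ((Finset.range (addOrderOf a)).image (fun k => k • a)).card = addOrderOf a := by
    rw [Finset.card_image_of_injOn, Finset.card_range]
    intro k hk l hl hkl
    exact nsmul_injOn_Iio_addOrderOf (by simpa using hk) (by simpa using hl) hkl
  have heq := Finset.eq_of_subset_of_card_le hsub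
    (by rw [hcard]; exact IsAddCyclic.card_nsmul_eq_zero_le hN)
  have hb : b ∈ Finset.univ.filter fun x : G => addOrderOf a • x = 0 := by
    simp [h, addOrderOf_nsmul_eq_zero]
  rw [← heq] at hb
  obtain ⟨k, hk, hkb⟩ := Finset.mem_image.1 hb
  obtain ⟨α, hα0, hα, hαb⟩ : ∃ α, 0 < α ∧ α ≤ addOrderOf a ∧ b = α • a := by
    rcases Nat.eq_zero_or_pos k with rfl | hk0
    · exact ⟨addOrderOf a, hN, le_rfl, by rw [← hkb, addOrderOf_nsmul_eq_zero]; simp⟩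
    · exact ⟨k, hk0, (Finset.mem_range.1 hk).le, hkb.symm⟩
  refine ⟨α, hα0, hα, ?_, hαb⟩
  rw [hαb, addOrderOf_nsmul] at h
  have hdiv := Nat.gcd_dvd_left (addOrderOf a) α
  rw [eq_comm, Nat.div_eq_iff_eq_mul_left (Nat.gcd_pos_of_pos_left _ hN) hdiv] at h
  have : Nat.gcd (addOrderOf a) α = 1 := Nat.eq_of_mul_eq_mul_left hN (by rw [← h, mul_one])
  exact Nat.Coprime.symm this

/-- The data of two elements `g`, `h` whose multiples `x • g`, `y • h` generate the intersection of
the groups generated by `g` and `h`. -/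
structure PairData (g h : G) (N x y α : ℕ) : Prop where
  pos : 0 < N
  left_pos : 0 < x
  right_pos : 0 < y
  order_left : addOrderOf g = N * x
  order_right : addOrderOf h = N * y
  coprime : x.Coprime y
  mult_pos : 0 < α
  mult_le : α ≤ N
  mult_coprime : α.Coprime N
  eq : y • h = α • x • g

theorem exists_pairData [Finite G] [IsAddCyclic G] (g h : G) : ∃ N x y α, PairData g h N x y α := by
  obtain ⟨N, x, y, hN, hcop, h1, h2⟩ := Nat.exists_coprime' (m := addOrderOf g)
    (n := addOrderOf h) (Nat.gcd_pos_of_pos_left _ (addOrderOf_pos g))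
  have hx : 0 < x := Nat.pos_of_ne_zero fun h0 => by
    rw [h0, zero_mul] at h1; exact (addOrderOf_pos g).ne' h1
  have hy : 0 < y := Nat.pos_of_ne_zero fun h0 => by
    rw [h0, zero_mul] at h2; exact (addOrderOf_pos h).ne' h2
  have hxo : addOrderOf (x • g) = N := by
    rw [addOrderOf_nsmul_of_dvd hx.ne' (Dvd.intro _ h1.symm), h1, Nat.mul_div_cancel_left _ hx]
  have hyo : addOrderOf (y • h) = N := by
    rw [addOrderOf_nsmul_of_dvd hy.ne' (Dvd.intro _ h2.symm), h2, Nat.mul_div_cancel_left _ hy]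
  obtain ⟨α, h3, h4, h5, h6⟩ := exists_nsmul_eq_of_addOrderOf_eq (hxo.trans hyo.symm)
  rw [hxo] at h4 h5
  exact ⟨N, x, y, α, hN, hx, hy, by rw [h1, mul_comm], by rw [h2, mul_comm], hcop, h3, h4, h5, h6⟩

theorem PairData.zero_sum_iff {g h : G} {N x y α : ℕ} (P : PairData g h N x y α) (X Y : ℕ) :
    (x * X) • g + (y * Y) • h = 0 ↔ N ∣ X + Y * α := by
  have h1 : (y * Y) • h = (x * (Y * α)) • g := by
    rw [mul_comm y, mul_nsmul', P.eq, ← mul_nsmul', ← mul_nsmul']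
    congr 1
    ring
  rw [h1, ← add_nsmul, ← mul_add, ← addOrderOf_dvd_iff_nsmul_eq_zero, P.order_left, mul_comm N x]
  exact Nat.mul_dvd_mul_iff_left P.left_pos

theorem PairData.dvd_of_zero_sum {g h : G} {N x y α : ℕ} (P : PairData g h N x y α) {X Y : ℕ}
    (h0 : X • g + Y • h = 0) : x ∣ X ∧ y ∣ Y := by
  constructor
  · have h1 : addOrderOf h • (X • g + Y • h) = 0 := by rw [h0, nsmul_zero]
    rw [nsmul_add, nsmul_left_comm _ Y, addOrderOf_nsmul_eq_zero, nsmul_zero, add_zero,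
      ← mul_nsmul', ← addOrderOf_dvd_iff_nsmul_eq_zero, P.order_left, P.order_right,
      mul_assoc] at h1
    exact P.coprime.dvd_of_dvd_mul_left (Nat.dvd_of_mul_dvd_mul_left P.pos h1)
  · have h1 : addOrderOf g • (X • g + Y • h) = 0 := by rw [h0, nsmul_zero]
    rw [nsmul_add, nsmul_left_comm _ X, addOrderOf_nsmul_eq_zero, nsmul_zero, zero_add,
      ← mul_nsmul', ← addOrderOf_dvd_iff_nsmul_eq_zero, P.order_left, P.order_right,
      mul_assoc] at h1
    exact P.coprime.symm.dvd_of_dvd_mul_left (Nat.dvd_of_mul_dvd_mul_left P.pos h1)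

theorem PairData.minZeroSum {g h : G} {N x y α : ℕ} (P : PairData g h N x y α) (hg : g ∈ G₀)
    (hh : h ∈ G₀) {X Y : ℕ} (h0 : 0 < X + Y) (hd : N ∣ X + Y * α)
    (hmin : ∀ X' Y', X' ≤ X → Y' ≤ Y → N ∣ X' + Y' * α →
      (X' = 0 ∧ Y' = 0) ∨ (X' = X ∧ Y' = Y)) :
    MinZeroSum G₀ (triple g h g (x * X) (y * Y) 0) := by
  refine minZeroSum_triple hg hh hg ?_ ?_ ?_
  · rcases Nat.eq_zero_or_pos X with h | h
    · have := Nat.mul_pos P.right_pos (show 0 < Y by omega)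
      omega
    · have := Nat.mul_pos P.left_pos h
      omega
  · rw [zero_nsmul, add_zero, P.zero_sum_iff]
    exact hd
  · intro X' Y' z' hX hY hz hs
    obtain rfl : z' = 0 := by omega
    rw [zero_nsmul, add_zero] at hs
    obtain ⟨⟨X', rfl⟩, ⟨Y', rfl⟩⟩ := P.dvd_of_zero_sum hs
    rw [P.zero_sum_iff] at hs
    rcases hmin X' Y' (Nat.le_of_mul_le_mul_left hX P.left_pos)
      (Nat.le_of_mul_le_mul_left hY P.right_pos) hs with ⟨rfl, rfl⟩ | ⟨rfl, rfl⟩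
    · simp
    · simp

/-- The atoms (xg)^N and (xg)^(N-α)(yh), written in terms of g and h, have the same weight. -/
theorem IsLengthWeight.pair_weight (W : IsLengthWeight G₀ D θ u) {g h : G} {N x y α : ℕ}
    (P : PairData g h N x y α) (hg : g ∈ G₀) (hh : h ∈ G₀) : y • θ h = α • x • θ g := by
  have h1 : N • x • θ g = u := by
    rw [← mul_nsmul', ← P.order_left]
    exact W.order_nsmul hg (by rw [P.order_left]; exact Nat.mul_pos P.pos P.left_pos)
  have hα := P.mult_pos
  have hαN := P.mult_le
  have h2 := W.map_sum _ (P.minZeroSum hg hh (X := N - α) (Y := 1) (by omega)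
    (by rw [one_mul, Nat.sub_add_cancel P.mult_le]) (by
      intro X' Y' hX hY hd
      rcases Nat.eq_zero_or_pos Y' with rfl | hY'
      · rw [zero_mul, add_zero] at hd
        exact Or.inl ⟨Nat.eq_zero_of_dvd_of_lt hd (by omega), rfl⟩
      · obtain rfl : Y' = 1 := by omega
        have := Nat.le_of_dvd (by omega) hd
        exact Or.inr ⟨by omega, rfl⟩))
  rw [triple_map_sum, zero_nsmul, add_zero, mul_one, mul_comm x, mul_nsmul'] at h2
  have h3 : (N - α) • x • θ g + α • x • θ g = u := by
    rw [← add_nsmul, Nat.sub_add_cancel P.mult_le, h1]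
  exact add_left_cancel (h2.trans h3.symm)

theorem IsLengthWeight.pair_dvd (W : IsLengthWeight G₀ D θ u) {g h : G} {N x y α : ℕ}
    (P : PairData g h N x y α) (hg : g ∈ G₀) (hh : h ∈ G₀) {a b j : ℕ} (h0 : 0 < a + b)
    (hd : a + b * α = j * N) (hmin : ∀ X' Y', X' ≤ a → Y' ≤ b → N ∣ X' + Y' * α →
      (X' = 0 ∧ Y' = 0) ∨ (X' = a ∧ Y' = b)) : (D : ℤ) ∣ (j : ℤ) - 1 := by
  have h1 : N • x • θ g = u := by
    rw [← mul_nsmul', ← P.order_left]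
    exact W.order_nsmul hg (by rw [P.order_left]; exact Nat.mul_pos P.pos P.left_pos)
  refine W.dvd_sub_one (P.minZeroSum hg hh h0 (by rw [hd]; exact Nat.dvd_mul_left _ _) hmin) ?_
  rw [triple_map_sum, zero_nsmul, add_zero, mul_comm y, mul_nsmul' _ b, W.pair_weight P hg hh,
    ← mul_nsmul', mul_comm x, mul_nsmul', ← add_nsmul, hd, mul_nsmul', h1, natCast_zsmul]

/-- Divide N = qα + ρ and let s = ⌈α/ρ⌉, σ = sρ - α. The atoms (yh)^N, of norm α, and
(xg)^σ(yh)^(sq+1), of norm s, give α ≡ s ≡ 1 mod D. Then D divides ρ - σ - 1, which lies in [0, D),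
so σ = ρ - 1 and α = 1 + ρ(s - 1). -/
theorem IsLengthWeight.pair_structure (W : IsLengthWeight G₀ D θ u) {g h : G} {N x y α : ℕ}
    (P : PairData g h N x y α) (hg : g ∈ G₀) (hh : h ∈ G₀) (hα : α ≠ 1) (hN : N ≤ D * D) :
    ∃ q ρ t, 0 < q ∧ 0 < ρ ∧ 0 < t ∧ N = q * α + ρ ∧ α = 1 + ρ * t * D := by
  have hα0 := P.mult_pos
  have hαN : α < N := by
    refine lt_of_le_of_ne P.mult_le fun h => ?_
    have := P.mult_coprime
    rw [h, Nat.coprime_self] at this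
    omega
  have hρ : 0 < N % α := by
    refine Nat.pos_of_ne_zero fun h => hα ?_
    exact Nat.Coprime.eq_one_of_dvd P.mult_coprime (Nat.dvd_of_mod_eq_zero h)
  have hN0 := Nat.div_add_mod N α
  have hρα := Nat.mod_lt N hα0
  have hq : 0 < N / α := Nat.div_pos hαN.le hα0
  obtain ⟨q, hqdef⟩ : ∃ q, q = N / α := ⟨_, rfl⟩
  obtain ⟨ρ, hρdef⟩ : ∃ ρ, ρ = N % α := ⟨_, rfl⟩
  rw [← hqdef] at hN0 hq
  rw [← hρdef] at hN0 hρα hρ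
  rw [mul_comm] at hN0
  obtain ⟨s, σ, hs, hσ⟩ : ∃ s σ, s * ρ = α + σ ∧ σ < ρ := by
    refine ⟨(α + ρ - 1) / ρ, (ρ - 1) - (α + ρ - 1) % ρ, ?_, by omega⟩
    have h1 := Nat.div_add_mod (α + ρ - 1) ρ
    have h2 := Nat.mod_lt (α + ρ - 1) hρ
    rw [mul_comm]
    omega
  have hdα : (D : ℤ) ∣ (α : ℤ) - 1 := by
    refine W.pair_dvd P hg hh (a := 0) (b := N) (by omega) (by ring) fun X' Y' hX hY hd => ?_
    obtain rfl : X' = 0 := by omega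
    rw [zero_add] at hd
    have h1 := P.mult_coprime.symm.dvd_of_dvd_mul_right hd
    rcases Nat.eq_zero_or_pos Y' with h | h
    · exact Or.inl ⟨rfl, h⟩
    · exact Or.inr ⟨rfl, le_antisymm hY (Nat.le_of_dvd h h1)⟩
  have hds : (D : ℤ) ∣ (s : ℤ) - 1 := by
    have hsum : σ + (s * q + 1) * α = s * N := by
      rw [← hN0, mul_add, hs]; ring
    refine W.pair_dvd P hg hh (a := σ) (b := s * q + 1) (by omega) hsum
      fun X' Y' hX hY ⟨j, hj⟩ => ?_
    rcases Nat.eq_zero_or_pos j with rfl | hj0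
    · left
      have : Y' * α = 0 := by omega
      rw [mul_eq_zero] at this
      omega
    · right
      have hjs : s ≤ j := by
        by_contra hlt
        push Not at hlt
        have h1 : j * ρ + ρ ≤ s * ρ := by
          rw [← Nat.succ_mul]; exact Nat.mul_le_mul_right _ hlt
        have h2 : ρ ≤ j * ρ := Nat.le_mul_of_pos_left _ hj0
        have h3 : X' + Y' * α = j * q * α + j * ρ := by rw [hj, ← hN0]; ring
        have h4 : j * q < Y' := by
          refine Nat.lt_of_mul_lt_mul_right (a := α) ?_
          omega
        have h5 : (j * q + 1) * α ≤ Y' * α := Nat.mul_le_mul_right _ h4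
        rw [add_mul, one_mul] at h5
        omega
      have h1 : N * s ≤ N * j := Nat.mul_le_mul_left _ hjs
      have h2 : Y' * α ≤ (s * q + 1) * α := Nat.mul_le_mul_right _ hY
      rw [mul_comm] at hsum
      have h3 : Y' * α = (s * q + 1) * α := by
        rw [mul_comm s N] at hsum
        rw [mul_comm α] at hsum
        omega
      refine ⟨?_, Nat.eq_of_mul_eq_mul_right hα0 h3⟩
      rw [mul_comm s N] at hsum
      rw [mul_comm α] at hsum
      omega
  have hs2 : 2 ≤ s := by
    by_contra h
    have : s * ρ ≤ 1 * ρ := Nat.mul_le_mul_right _ (by omega)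
    omega
  have hsD : D + 1 ≤ s := by
    have := Int.le_of_dvd (by omega) hds
    omega
  -- Otherwise sρ ≥ (D + 1)² would exceed α + σ, which is below N ≤ D².
  have hρD : ρ ≤ D := by
    by_contra h
    push Not at h
    have h1 : D * (D + 1) ≤ D * ρ := Nat.mul_le_mul_left _ h
    have h2 : (D + 1) * ρ ≤ s * ρ := Nat.mul_le_mul_right _ hsD
    have h3 : D * (D + 1) = D * D + D := by ring
    have h4 : (D + 1) * ρ = D * ρ + ρ := by ring
    omega
  have hστ : (D : ℤ) ∣ (ρ : ℤ) - σ - 1 := by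
    have h1 := dvd_sub hdα (hds.mul_left (ρ : ℤ))
    have h2 : (s : ℤ) * ρ = α + σ := by exact_mod_cast hs
    rwa [show (α : ℤ) - 1 - ρ * (s - 1) = ρ - σ - 1 by linear_combination -h2] at h1
  have hσ1 : ρ = σ + 1 := by
    have := Int.eq_zero_of_dvd_of_nonneg_of_lt (m := (ρ : ℤ) - σ - 1) (n := (D : ℤ)) (by omega)
      (by omega) hστ
    omega
  obtain ⟨t, ht⟩ := hds
  have ht0 : 0 < t := by
    by_contra h
    push Not at h
    have : (D : ℤ) * t ≤ 0 := mul_nonpos_of_nonneg_of_nonpos (by positivity) h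
    omega
  lift t to ℕ using ht0.le
  refine ⟨q, ρ, t, hq, hρ, by exact_mod_cast ht0, hN0.symm, ?_⟩
  zify
  have h2 : (s : ℤ) * ρ = α + σ := by exact_mod_cast hs
  have h3 : (ρ : ℤ) = σ + 1 := by exact_mod_cast hσ1
  linear_combination -h2 + ρ * ht + h3

end Weights

/-! ### A divisor bound and the cross number argument -/

theorem card_divisors_le (m b : ℕ) (hb : 0 < b) : m.divisors.card ≤ b + m / b := by
  have h1 : (m.divisors.filter (· ≤ b)).card ≤ b := by
    refine (Finset.card_le_card (t := Finset.Icc 1 b) fun d hd => ?_).trans (by simp)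
    rw [Finset.mem_filter] at hd
    exact Finset.mem_Icc.2 ⟨Nat.pos_of_mem_divisors hd.1, hd.2⟩
  have h2 : (m.divisors.filter fun d => ¬ d ≤ b).card ≤ m / b := by
    refine (Finset.card_le_card_of_injOn (t := Finset.Icc 1 (m / b)) (fun d => m / d) ?_ ?_).trans
      (by simp)
    · intro d hd
      rw [Finset.mem_coe, Finset.mem_filter, Nat.mem_divisors] at hd
      have hd0 : 0 < d := by omega
      rw [Finset.mem_coe, Finset.mem_Icc]
      exact ⟨Nat.div_pos (Nat.le_of_dvd (Nat.pos_of_ne_zero hd.1.2) hd.1.1) hd0,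
        Nat.div_le_div_left (by omega) hb⟩
    · intro d hd d' hd' h
      rw [Finset.mem_coe, Finset.mem_filter, Nat.mem_divisors] at hd hd'
      have h3 := Nat.div_mul_cancel hd.1.1
      have h4 := Nat.div_mul_cancel hd'.1.1
      simp only at h
      rw [h] at h3
      have h5 : 0 < m / d' := Nat.div_pos
        (Nat.le_of_dvd (Nat.pos_of_ne_zero hd'.1.2) hd'.1.1) (by omega)
      exact Nat.eq_of_mul_eq_mul_left h5 (h3.trans h4.symm)
  have h3 := Finset.card_filter_add_card_filter_not (s := m.divisors) (fun d => d ≤ b)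
  omega

section CrossNumber

universe v

variable {G : Type v} [AddCommGroup G] {G₀ : Set G} {D : ℕ}

theorem sum_map_eq_sum_count {M : Type*} [AddCommMonoid M] [DecidableEq G] (s : Finset G)
    (A : Multiset G) (hA : ∀ g ∈ A, g ∈ s) (f : G → M) :
    (A.map f).sum = ∑ g ∈ s, A.count g • f g := by
  rw [Finset.sum_multiset_map_count]
  refine Finset.sum_subset (fun g hg => hA g (Multiset.mem_toFinset.1 hg)) fun g _ hg => ?_
  rw [Multiset.count_eq_zero.2 (fun h => hg (Multiset.mem_toFinset.2 h)), zero_nsmul]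

/-- If α = 1 for all pairs, every g ∈ G₀ equals (m/ord g)e for one common e, where m is the lcm of
the orders. The norm of an atom is then its cross number: it is ≡ 1 mod D and at most |G₀|. As |G₀|
is at most the number of divisors of m, hence at most D, all norms are 1 and all length differences
vanish. -/
theorem IsLengthGenerator.exists_pairData_ne_one [Finite G] [IsAddCyclic G]
    (h : IsLengthGenerator G₀ D) (hD : 112 ≤ D) (hcard : Nat.card G ≤ 10 * D) :
    ∃ g ∈ G₀, ∃ h ∈ G₀, ∃ N x y α, PairData g h N x y α ∧ α ≠ 1 := by
  classical
  by_contra! hcon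
  obtain ⟨X, _, θ, u, W⟩ := h.exists_isLengthWeight
  obtain ⟨s, hs⟩ : ∃ s : Finset G, ∀ g, g ∈ s ↔ g ∈ G₀ :=
    ⟨(Set.toFinite G₀).toFinset, fun g => by simp⟩
  obtain ⟨m, hm⟩ : ∃ m, m = s.lcm addOrderOf := ⟨_, rfl⟩
  have hdm : ∀ g ∈ s, addOrderOf g ∣ m := fun g hg => by rw [hm]; exact Finset.dvd_lcm hg
  have hmcard : m ∣ Nat.card G := by
    rw [hm]; exact Finset.lcm_dvd fun g _ => addOrderOf_dvd_natCard g
  have hm0 : 0 < m := Nat.pos_of_dvd_of_pos hmcard Nat.card_pos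
  obtain ⟨c, hc⟩ : ∃ c : G → ℕ, ∀ g ∈ s, m = addOrderOf g * c g := by
    refine ⟨fun g => m / addOrderOf g, fun g hg => (Nat.mul_div_cancel' (hdm g hg)).symm⟩
  have hc0 : ∀ g ∈ s, 0 < c g := fun g hg => Nat.pos_of_ne_zero fun h0 => by
    have := hc g hg
    rw [h0, mul_zero] at this
    omega
  have hsne : s.Nonempty := by
    obtain ⟨z, z', hz, hz', -, hcz⟩ := h.attained
    obtain ⟨A, hA⟩ := Multiset.card_pos_iff_exists_mem.1 (show 0 < Multiset.card z by omega)
    obtain ⟨g, hg⟩ := Multiset.exists_mem_of_ne_zero (hz A hA).ne_zero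
    exact ⟨g, (hs g).2 ((hz A hA).mem g hg)⟩
  have hrel : ∀ g ∈ s, ∀ g' ∈ s, c g' • g = c g • g' ∧ c g' • θ g = c g • θ g' := by
    intro g hg g' hg'
    obtain ⟨N, x, y, α, P⟩ := exists_pairData g g'
    have hα := hcon g ((hs g).1 hg) g' ((hs g').1 hg') N x y α P
    subst hα
    have h1 := hc g hg
    have h2 := hc g' hg'
    rw [P.order_left] at h1
    rw [P.order_right] at h2
    have h3 : x * c g = y * c g' := by
      refine Nat.eq_of_mul_eq_mul_left P.pos ?_
      rw [← mul_assoc, ← mul_assoc, ← h1, ← h2]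
    obtain ⟨r, hr⟩ : y ∣ c g := P.coprime.symm.dvd_of_dvd_mul_left (Dvd.intro _ h3.symm)
    have hr' : c g' = x * r := by
      refine Nat.eq_of_mul_eq_mul_left P.right_pos ?_
      rw [← h3, hr]; ring
    have h4 := P.eq
    have h5 := W.pair_weight P ((hs g).1 hg) ((hs g').1 hg')
    rw [one_nsmul] at h4 h5
    rw [hr, hr', mul_comm x, mul_comm y, mul_nsmul', mul_nsmul', mul_nsmul', mul_nsmul', h4, h5]
    exact ⟨rfl, rfl⟩
  -- The cofactors c g = m/ord g have gcd 1; Bézout coefficients combine the g into e, and their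
  -- weights into the weight ε of e.
  obtain ⟨v, hv⟩ := Finset.gcd_eq_sum_mul s fun g => (c g : ℤ)
  have hgcd : s.gcd (fun g => (c g : ℤ)) = 1 := by
    have hd : ∀ g ∈ s, (s.gcd fun g => (c g : ℤ)).natAbs ∣ c g := fun g hg =>
      Int.natAbs_dvd_natAbs.2 (Finset.gcd_dvd (f := fun g => (c g : ℤ)) hg)
    obtain ⟨d, hdd⟩ : ∃ d, d = (s.gcd fun g => (c g : ℤ)).natAbs := ⟨_, rfl⟩
    rw [← hdd] at hd
    obtain ⟨g₁, hg₁⟩ := hsne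
    obtain ⟨m', hm'⟩ : d ∣ m := by rw [hc g₁ hg₁]; exact (hd g₁ hg₁).mul_left _
    have hd0 : 0 < d := Nat.pos_of_ne_zero fun h => by rw [h] at hm'; omega
    have h1 : m ∣ m' := by
      rw [hm]
      refine Finset.lcm_dvd fun g hg => ?_
      obtain ⟨r, hr⟩ := hd g hg
      refine ⟨r, Nat.eq_of_mul_eq_mul_left hd0 ?_⟩
      rw [← hm', hc g hg, hr]; ring
    have h2 : d = 1 := by
      have hm'0 : 0 < m' := Nat.pos_of_ne_zero fun h => by rw [h] at hm'; omega
      have h3 := Nat.le_of_dvd hm'0 h1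
      have h4 : d * m' ≤ 1 * m' := by rw [← hm', one_mul]; exact h3
      have := Nat.le_of_mul_le_mul_right h4 hm'0
      omega
    have h3 : normalize (s.gcd fun g => (c g : ℤ)) = s.gcd fun g => (c g : ℤ) :=
      Finset.normalize_gcd
    have h4 := Int.nonneg_of_normalize_eq_self h3
    omega
  rw [hgcd] at hv
  obtain ⟨e, he⟩ : ∃ e, e = ∑ g ∈ s, v g • g := ⟨_, rfl⟩
  obtain ⟨ε, hε⟩ : ∃ ε, ε = ∑ g ∈ s, v g • θ g := ⟨_, rfl⟩
  have hce : ∀ g ∈ s, c g • e = g := by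
    intro g hg
    rw [he, Finset.smul_sum]
    have h1 : ∀ g' ∈ s, c g • v g' • g' = ((c g' : ℤ) * v g') • g := by
      intro g' hg'
      rw [smul_comm, ← (hrel g hg g' hg').1, mul_comm, mul_zsmul, natCast_zsmul]
    rw [Finset.sum_congr rfl h1, ← Finset.sum_smul, ← hv, one_zsmul]
  have hcε : ∀ g ∈ s, c g • ε = θ g := by
    intro g hg
    rw [hε, Finset.smul_sum]
    have h1 : ∀ g' ∈ s, c g • v g' • θ g' = ((c g' : ℤ) * v g') • θ g := by
      intro g' hg'
      rw [smul_comm, ← (hrel g hg g' hg').2, mul_comm, mul_zsmul, natCast_zsmul]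
    rw [Finset.sum_congr rfl h1, ← Finset.sum_smul, ← hv, one_zsmul]
  have hme : m ∣ addOrderOf e := by
    rw [hm]
    refine Finset.lcm_dvd fun g hg => addOrderOf_dvd_of_nsmul_eq_zero ?_
    rw [← hce g hg, nsmul_left_comm, addOrderOf_nsmul_eq_zero, nsmul_zero]
  have hmε : m • ε = u := by
    obtain ⟨g, hg⟩ := hsne
    rw [hc g hg, mul_nsmul', hcε g hg, W.order_nsmul ((hs g).1 hg) (addOrderOf_pos g)]
  have hscard : s.card ≤ D := by
    have h1 : s.card ≤ m.divisors.card := by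
      refine Finset.card_le_card_of_injOn addOrderOf (fun g hg => ?_) fun g hg g' hg' h => ?_
      · rw [Finset.mem_coe, Nat.mem_divisors]
        exact ⟨hdm g hg, hm0.ne'⟩
      · have h2 := hc g hg
        rw [hc g' hg', h] at h2
        have h3 := Nat.eq_of_mul_eq_mul_left (addOrderOf_pos g') h2
        rw [← hce g hg, ← hce g' hg', h3]
    -- The bound 100 + m/100 is at most 100 + D/10, and this is at most D for D ≥ 112.
    have h2 := card_divisors_le m 100 (by norm_num)
    have h3 := Nat.le_of_dvd Nat.card_pos hmcard
    omega
  have hzero : LengthsCongr G₀ 0 := by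
    refine lengthsCongr_of_norm hm0 c fun A hA => ⟨1, ?_, by simp⟩
    have hAs : ∀ g ∈ A, g ∈ s := fun g hg => (hs g).2 (hA.mem g hg)
    have hsum : ∀ {M : Type v} [AddCommGroup M] (f : G → M) (t : M),
        (∀ g ∈ s, c g • t = f g) → (A.map f).sum = (A.map c).sum • t := by
      intro M _ f t hf
      rw [sum_map_eq_sum_count s A hAs, sum_map_eq_sum_count s A hAs, Finset.sum_smul]
      refine Finset.sum_congr rfl fun g hg => ?_
      rw [← hf g hg, smul_eq_mul, mul_nsmul']
    have h1 := hsum id e hce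
    rw [Multiset.map_id, hA.sum_eq] at h1
    obtain ⟨l, hl⟩ := hme.trans (addOrderOf_dvd_of_nsmul_eq_zero h1.symm)
    have h2 := hsum θ ε hcε
    rw [hl, mul_comm, mul_nsmul', hmε, ← natCast_zsmul] at h2
    have h3 := W.dvd_sub_one hA h2
    have hl0 : 0 < l := by
      obtain ⟨g, hg⟩ := Multiset.exists_mem_of_ne_zero hA.ne_zero
      have h4 : c g ≤ (A.map c).sum := Multiset.le_sum_of_mem (Multiset.mem_map_of_mem c hg)
      have h5 := hc0 g (hAs g hg)
      exact Nat.pos_of_ne_zero fun h => by rw [h] at hl; omega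
    -- No g occurs more than ord g times in an atom, so each g contributes at most m to the sum of
    -- coefficients.
    have hlD : l ≤ D := by
      refine le_trans ?_ hscard
      refine Nat.le_of_mul_le_mul_left ?_ hm0
      rw [← hl, sum_map_eq_sum_count s A hAs, mul_comm m, ← smul_eq_mul s.card,
        ← Finset.sum_const]
      refine Finset.sum_le_sum fun g hg => ?_
      rw [smul_eq_mul]
      conv_rhs => rw [hc g hg]
      refine Nat.mul_le_mul_right _ ?_
      by_contra hlt
      push Not at hlt
      have h6 : Multiset.replicate (addOrderOf g) g ≤ A :=
        Multiset.le_count_iff_replicate_le.1 hlt.le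
      rcases hA.minimal _ h6 (by simp [addOrderOf_nsmul_eq_zero]) with h7 | h7
      · have := congrArg Multiset.card h7
        have h8 := addOrderOf_pos g
        rw [Multiset.card_replicate, Multiset.card_zero] at this
        omega
      · rw [← h7, Multiset.count_replicate_self] at hlt
        omega
    have h9 := Int.eq_zero_of_dvd_of_nonneg_of_lt (m := (l : ℤ) - 1) (n := (D : ℤ)) (by omega)
      (by omega) h3
    rw [hl, mul_comm]
    congr 1
    omega
  obtain ⟨z, z', hz, hz', hzz, hcz⟩ := h.attained
  have := hzero z z' hz hz' hzz
  have hp := h.pos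
  rw [Nat.cast_zero, zero_dvd_iff] at this
  omega

end CrossNumber

/-! ### The finitely many parameters allowed by n ≤ 10D -/

section Numerics

theorem mem_gcdSet_of_eq {m q ρ κ L k : ℕ} (hq : 0 < q) (hρ : 0 < ρ) (hκ : 0 < κ) (hk : 0 < k)
    (hL : Nat.lcm ρ κ = L) (hκm : κ ∣ m) (hm : m = q * (1 + L * k) + ρ) : k ∈ gcdSet m :=
  mem_gcdSet_iff.2 ⟨q, ρ, κ, hq, hρ, hκ, hk, hκm, by rw [hL]; exact hm⟩

/-- The pairs `(c, t)` for which no element of the sets `gcdSet` arises. -/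
def IsExceptional (c t : ℕ) : Prop :=
  (c = 1 ∧ 3 ≤ t ∧ t ≤ 9) ∨ (c = 2 ∧ (t = 2 ∨ t = 4)) ∨ (c = 3 ∧ t = 3) ∨ (c = 4 ∧ t = 2)

/-- Expanding gives n = μqρtD + μ(q + ρ), hence μqρt ≤ 9. For t = 1 take m = n/μ and κ = 1; for t ≥
2 a different triple (q, ρ, κ) often represents n or a divisor of n. -/
theorem mem_gcdSet_or_isExceptional {n D μ q ρ t : ℕ} (hD : 0 < D) (hn : n ≤ 10 * D) (hμ : 0 < μ)
    (hq : 0 < q) (hρ : 0 < ρ) (ht : 0 < t) (h : n = μ * (q * (1 + ρ * t * D) + ρ)) :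
    (∃ m, m ∣ n ∧ D ∈ gcdSet m) ∨
      (μ = 1 ∧ ∃ c, ((q = 1 ∧ ρ = c) ∨ (q = c ∧ ρ = 1)) ∧ n = c * t * D + c + 1 ∧
        IsExceptional c t) := by
  have hprod : μ * q * ρ * t ≤ 9 := by
    have h1 : μ * q * ρ * t * D < 10 * D := by
      have h2 : n = μ * q * ρ * t * D + μ * (q + ρ) := by rw [h]; ring
      have h3 : 0 < μ * (q + ρ) := by positivity
      omega
    have := Nat.lt_of_mul_lt_mul_right h1
    omega
  rcases (show t = 1 ∨ 2 ≤ t by omega) with rfl | ht2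
  · left
    refine ⟨q * (1 + ρ * 1 * D) + ρ, Dvd.intro_left _ h.symm,
      mem_gcdSet_of_eq hq hρ one_pos hD (L := ρ) (by simp) (one_dvd _) (by ring)⟩
  have h4 : μ * q * ρ ≤ 4 := by
    have : μ * q * ρ * 2 ≤ μ * q * ρ * t := Nat.mul_le_mul_left _ ht2
    omega
  have hμ4 : μ ≤ 4 := by
    have h1 : μ * 1 ≤ μ * (q * ρ) := Nat.mul_le_mul_left _ (Nat.mul_pos hq hρ)
    have h2 : μ * q * ρ = μ * (q * ρ) := by ring
    omega
  have hq4 : q ≤ 4 := by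
    have h1 : q * 1 ≤ q * (μ * ρ) := Nat.mul_le_mul_left _ (Nat.mul_pos hμ hρ)
    have h2 : μ * q * ρ = q * (μ * ρ) := by ring
    omega
  have hρ4 : ρ ≤ 4 := by
    have h1 : ρ * 1 ≤ ρ * (μ * q) := Nat.mul_le_mul_left _ (Nat.mul_pos hμ hq)
    have h2 : μ * q * ρ = ρ * (μ * q) := by ring
    omega
  have d22 : ∀ m, m = 2 * D + 2 → D ∈ gcdSet m := fun m hm =>
    mem_gcdSet_of_eq (q := 1) (ρ := 1) (κ := 2) (L := 2) (by omega) (by omega) (by omega) hD rfl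
      (by omega) (by omega)
  have d63 : ∀ m, m = 6 * D + 3 → D ∈ gcdSet m := fun m hm =>
    mem_gcdSet_of_eq (q := 2) (ρ := 1) (κ := 3) (L := 3) (by omega) (by omega) (by omega) hD rfl
      (by omega) (by omega)
  have d64 : ∀ m, m = 6 * D + 4 → D ∈ gcdSet m := fun m hm =>
    mem_gcdSet_of_eq (q := 3) (ρ := 1) (κ := 2) (L := 2) (by omega) (by omega) (by omega) hD rfl
      (by omega) (by omega)
  have d84 : ∀ m, m = 8 * D + 4 → D ∈ gcdSet m := fun m hm =>
    mem_gcdSet_of_eq (q := 2) (ρ := 2) (κ := 4) (L := 4) (by omega) (by omega) (by omega) hD rfl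
      (by omega) (by omega)
  have d86 : ∀ m, m = 8 * D + 6 → D ∈ gcdSet m := fun m hm =>
    mem_gcdSet_of_eq (q := 4) (ρ := 2) (κ := 1) (L := 2) (by omega) (by omega) (by omega) hD rfl
      (by omega) (by omega)
  have d96 : ∀ m, m = 9 * D + 6 → D ∈ gcdSet m := fun m hm =>
    mem_gcdSet_of_eq (q := 3) (ρ := 3) (κ := 1) (L := 3) (by omega) (by omega) (by omega) hD rfl
      (by omega) (by omega)
  have ht9 : t ≤ 9 := by
    have h1 : 1 * t ≤ μ * q * ρ * t := Nat.mul_le_mul_right _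
      (Nat.mul_pos (Nat.mul_pos hμ hq) hρ)
    omega
  unfold IsExceptional
  interval_cases μ <;> interval_cases q <;> interval_cases ρ <;>
    first
    | (exfalso; omega)
    | (interval_cases t <;>
        first
        | (exfalso; omega)
        | exact Or.inl ⟨n, dvd_rfl, d22 n (by omega)⟩
        | exact Or.inl ⟨n, dvd_rfl, d63 n (by omega)⟩
        | exact Or.inl ⟨n, dvd_rfl, d64 n (by omega)⟩
        | exact Or.inl ⟨n, dvd_rfl, d84 n (by omega)⟩
        | exact Or.inl ⟨n, dvd_rfl, d86 n (by omega)⟩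
        | exact Or.inl ⟨n, dvd_rfl, d96 n (by omega)⟩
        | exact Or.inl ⟨2 * D + 2, ⟨2, by omega⟩, d22 _ rfl⟩
        | exact Or.inl ⟨2 * D + 2, ⟨3, by omega⟩, d22 _ rfl⟩
        | exact Or.inl ⟨2 * D + 2, ⟨4, by omega⟩, d22 _ rfl⟩
        | exact Or.inr ⟨rfl, 1, Or.inl ⟨rfl, rfl⟩, by omega, by omega⟩
        | exact Or.inr ⟨rfl, _, Or.inl ⟨rfl, rfl⟩, by omega, by omega⟩
        | exact Or.inr ⟨rfl, _, Or.inr ⟨rfl, rfl⟩, by omega, by omega⟩)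

theorem eq_and_eq_of_mul_add_eq {D a b r s : ℕ} (hr : r < D) (hs : s < D)
    (h : a * D + r = b * D + s) : a = b ∧ r = s := by
  have h1 : (a * D + r) / D = a := by
    rw [mul_comm, Nat.mul_add_div (by omega), Nat.div_eq_of_lt hr, add_zero]
  have h2 : (b * D + s) / D = b := by
    rw [mul_comm, Nat.mul_add_div (by omega), Nat.div_eq_of_lt hs, add_zero]
  have : a = b := by rw [← h1, ← h2, h]
  subst this
  exact ⟨rfl, by omega⟩

end Numerics

/-! ### Exclusion of the exceptional pairs and the inclusion ⊆ -/

section Forward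

universe v

variable {G : Type v} [AddCommGroup G] {G₀ : Set G} {D : ℕ} {X : Type v} [AddCommGroup X]
  {θ : G → X} {u : X}

theorem IsLengthWeight.triple_dvd (W : IsLengthWeight G₀ D θ u) {e : G} {n a b : ℕ} (hn : 0 < n)
    (he : addOrderOf e = n) (heG : e ∈ G₀) (haG : a • e ∈ G₀) (hbG : b • e ∈ G₀) (ha : 0 < a)
    (han : a ≤ n) (hb : 0 < b) (hbn : b ≤ n) {x y z l : ℕ} (h0 : 0 < x + y + z)
    (hl : x + y * a + z * b = l * n)
    (hmin : ∀ x' y' z', x' ≤ x → y' ≤ y → z' ≤ z → n ∣ x' + y' * a + z' * b →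
      (x' = 0 ∧ y' = 0 ∧ z' = 0) ∨ (x' = x ∧ y' = y ∧ z' = z)) : (D : ℤ) ∣ (l : ℤ) - 1 := by
  have hu : n • θ e = u := by rw [← he]; exact W.order_nsmul heG (by omega)
  have hθ : ∀ k : ℕ, 0 < k → k ≤ n → k • e ∈ G₀ → θ (k • e) = k • θ e := by
    intro k hk hkn hkG
    have h1 := W.map_sum _ (minZeroSum_complement heG hkG hk (by omega))
    rw [triple_map_sum, he, zero_nsmul, add_zero, one_nsmul] at h1
    have h2 : (n - k) • θ e + k • θ e = u := by
      rw [← add_nsmul, Nat.sub_add_cancel hkn, hu]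
    exact add_left_cancel (h1.trans h2.symm)
  have hiff : ∀ x y z : ℕ, x • e + y • a • e + z • b • e = 0 ↔ n ∣ x + y * a + z * b := by
    intro x y z
    rw [← mul_nsmul', ← mul_nsmul', ← add_nsmul, ← add_nsmul, ← addOrderOf_dvd_iff_nsmul_eq_zero,
      he]
  refine W.dvd_sub_one (A := triple e (a • e) (b • e) x y z)
    (minZeroSum_triple heG haG hbG h0 ?_ ?_) ?_
  · rw [hiff, hl]
    exact Nat.dvd_mul_left _ _
  · intro x' y' z' hx hy hz h
    exact hmin x' y' z' hx hy hz ((hiff _ _ _).1 h)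
  · rw [triple_map_sum, hθ a ha han haG, hθ b hb hbn hbG, ← mul_nsmul', ← mul_nsmul', ← add_nsmul,
      ← add_nsmul, hl, mul_nsmul', hu, natCast_zsmul]

/-- If `e` generates a group of order `n = c b + 1`, then `-c e` and `b e` do not occur together. -/
theorem IsLengthWeight.not_mem_of_mul_add_one (W : IsLengthWeight G₀ D θ u) {e : G} {n c t b : ℕ}
    (he : addOrderOf e = n) (heG : e ∈ G₀) (hhG : (n - c) • e ∈ G₀) (hc : 2 ≤ c) (hcD : c ≤ D)
    (ht : 0 < t) (hb : b = t * D + 1) (hn : n = c * b + 1) (hcn : c * c ≤ n) : b • e ∉ G₀ := by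
  intro hbG
  have hcb : c * 1 ≤ c * b := Nat.mul_le_mul_left _ (by omega)
  have hbn : 1 * b ≤ c * b := Nat.mul_le_mul_right _ (by omega)
  have htD : 1 * D ≤ t * D := Nat.mul_le_mul_right _ ht
  obtain ⟨z, hz⟩ := Nat.exists_eq_add_of_le hcn
  obtain ⟨a, ha⟩ : ∃ a, n = a + c := ⟨n - c, by omega⟩
  rw [show n - c = a by omega] at hhG
  obtain ⟨l, hl⟩ : ∃ l, b + 1 = l + c := ⟨b + 1 - c, by omega⟩
  have hnz : (n : ℤ) = c * b + 1 := by exact_mod_cast hn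
  have haz : (n : ℤ) = a + c := by exact_mod_cast ha
  have hzz : (n : ℤ) = c * c + z := by exact_mod_cast hz
  have hlz : (b : ℤ) + 1 = l + c := by exact_mod_cast hl
  -- The sequence (-ce)(be)^(n-c²) is an atom: since cb ≡ -1 mod n, a subsequence with exponents y',
  -- z' has sum zero iff n ∣ c²y' + z'. Its norm is b + 1 - c, so D would divide c - 1.
  have key := W.triple_dvd (x := 0) (y := 1) (z := z) (l := l) (by omega) he heG hhG hbG (by omega)
    (by omega) (by omega) (by omega) (by omega) (by
      zify
      linear_combination -haz - (b : ℤ) * hzz + (n : ℤ) * hlz + (c : ℤ) * hnz) (by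
      intro x' y' z' hx hy hz' hd
      have h1 : n ∣ c * c * y' + z' := by
        have h2 : (n : ℤ) ∣ x' + y' * a + z' * b := by exact_mod_cast hd
        obtain rfl : x' = 0 := by omega
        have h3 : (n : ℤ) ∣ c * c * y' + z' := by
          have h4 := dvd_sub (Dvd.intro_left (c * y' + z' : ℤ) rfl : (n : ℤ) ∣ (c * y' + z') * n)
            (h2.mul_left (c : ℤ))
          rwa [show ((c * y' + z') * n - c * ((0 : ℕ) + y' * a + z' * b) : ℤ) =
            c * c * y' + z' by push_cast; linear_combination (c * y' : ℤ) * haz + z' * hnz] at h4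
        exact_mod_cast h3
      have h5 : c * c * y' ≤ c * c * 1 := Nat.mul_le_mul_left _ hy
      rcases Nat.eq_zero_or_pos (c * c * y' + z') with h6 | h6
      · left
        have h7 : c * c * y' = 0 := by omega
        have h8 : 0 < c * c := by positivity
        rw [mul_eq_zero] at h7
        omega
      · right
        have h7 := Nat.le_of_dvd h6 h1
        have h8 : y' = 1 := by
          by_contra h9
          obtain rfl : y' = 0 := by omega
          have : 0 < c * c := by positivity
          omega
        omega)
  have h1 : (D : ℤ) ∣ (c : ℤ) - 1 := by
    have h2 : (b : ℤ) = t * D + 1 := by exact_mod_cast hb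
    have h3 := dvd_sub (Dvd.intro_left (t : ℤ) rfl : (D : ℤ) ∣ t * D) key
    rwa [show (t * D - ((l : ℤ) - 1)) = c - 1 by linear_combination -h2 + hlz] at h3
  have := Int.le_of_dvd (by omega) h1
  omega

theorem IsLengthWeight.eq_of_dvd (W : IsLengthWeight G₀ D θ u) {e : G} {n c t b k : ℕ}
    (hD : 200 ≤ D) (hnD : n ≤ 10 * D)
    (he : addOrderOf e = n) (heG : e ∈ G₀) (hhG : (n - c) • e ∈ G₀) (hbG : b • e ∈ G₀)
    (hn : n = c * t * D + c + 1) (hct : IsExceptional c t) (hbk : n = b * k) (hb1 : b ≠ 1)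
    (hbn : b ≠ n) : c = 1 ∧ n = b * 2 := by
  have hc0 : 0 < c := by unfold IsExceptional at hct; omega
  have hc4 : c ≤ 4 := by unfold IsExceptional at hct; omega
  have ht2 : 2 ≤ t := by unfold IsExceptional at hct; omega
  have hct9 : c * t * D + c + 1 ≤ 10 * D := by omega
  have hb0 : 0 < b := Nat.pos_of_ne_zero fun h => by rw [h] at hbk; omega
  have hk2 : 2 ≤ k := by
    rcases (show k = 0 ∨ k = 1 ∨ 2 ≤ k by omega) with rfl | rfl | h
    · omega
    · omega
    · exact h
  have hb2 : b * 2 ≤ n := by rw [hbk]; exact Nat.mul_le_mul_left _ hk2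
  have hn400 : 400 ≤ n := by
    have h1 : 1 * 2 * 200 ≤ c * t * D := Nat.mul_le_mul (Nat.mul_le_mul hc0 ht2) hD
    omega
  obtain ⟨a, ha⟩ : ∃ a, n = a + c := ⟨n - c, by omega⟩
  rw [show n - c = a by omega] at hhG
  have haz : (n : ℤ) = a + c := by exact_mod_cast ha
  -- With l = ⌈b/c⌉ and x = lc - b, the sequence e^x(-ce)^l(be) is an atom of norm l, so l ≡ 1 mod
  -- D.
  obtain ⟨l, x, hl, hx⟩ : ∃ l x, l * c = b + x ∧ x < c := by
    refine ⟨(b + c - 1) / c, (c - 1) - (b + c - 1) % c, ?_, by omega⟩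
    have h1 := Nat.div_add_mod (b + c - 1) c
    have h2 := Nat.mod_lt (b + c - 1) hc0
    rw [mul_comm]
    omega
  have hlz : (l : ℤ) * c = b + x := by exact_mod_cast hl
  have hl0 : 0 < l := Nat.pos_of_ne_zero fun h => by rw [h] at hl; omega
  have aux : ∀ x' y' : ℕ, x' ≤ x → y' ≤ l → (n : ℤ) ∣ y' * c - x' → x' = 0 ∧ y' = 0 := by
    intro x' y' hx' hy' hd
    have h1 : y' * c ≤ l * c := Nat.mul_le_mul_right _ hy'
    have h2 := Int.eq_zero_of_abs_lt_dvd hd (by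
      rw [abs_lt]
      have h3 : ((y' * c : ℕ) : ℤ) ≤ (l * c : ℕ) := by exact_mod_cast h1
      push_cast at h3
      have h4 : (0 : ℤ) ≤ y' * c := by positivity
      constructor <;> omega)
    have h3 : y' * c = x' := by
      have : (y' : ℤ) * c = x' := by omega
      exact_mod_cast this
    have h4 : y' = 0 := by
      by_contra h5
      have : 1 * c ≤ y' * c := Nat.mul_le_mul_right _ (by omega)
      omega
    rw [h4] at h3
    omega
  have key := W.triple_dvd (x := x) (y := l) (z := 1) (l := l) (by omega) he heG hhG hbG (by omega)
    (by omega) hb0 (by omega) (by omega) (by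
      zify
      linear_combination -(l : ℤ) * haz - hlz) (by
      intro x' y' z' hx' hy' hz' hd
      have h2 : (n : ℤ) ∣ x' + y' * a + z' * b := by exact_mod_cast hd
      rcases (show z' = 0 ∨ z' = 1 by omega) with rfl | rfl
      · left
        have h3 := dvd_sub (Dvd.intro_left (y' : ℤ) rfl : (n : ℤ) ∣ y' * n) h2
        have h4 := aux x' y' hx' hy' (by
          rwa [show (y' * n - (x' + y' * a + (0 : ℕ) * b) : ℤ) = y' * c - x' by
            push_cast; linear_combination (y' : ℤ) * haz] at h3)
        exact ⟨h4.1, h4.2, rfl⟩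
      · right
        have h3 := dvd_sub h2 (Dvd.intro_left (y' : ℤ) rfl : (n : ℤ) ∣ y' * n)
        have h4 := aux (x - x') (l - y') (by omega) (by omega) (by
          rw [Nat.cast_sub hx', Nat.cast_sub hy']
          rwa [show (x' + y' * a + (1 : ℕ) * b - y' * n : ℤ) = (l - y') * c - (x - x') by
            push_cast; linear_combination -(y' : ℤ) * haz - hlz] at h3)
        omega)
  obtain ⟨s, hs⟩ := key
  have hs0 : 0 ≤ s := by
    by_contra h
    have : (D : ℤ) * s ≤ D * (-1) := mul_le_mul_of_nonneg_left (by omega) (by positivity)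
    omega
  lift s to ℕ using hs0
  have hls : l = s * D + 1 := by
    zify
    linear_combination hs
  rcases Nat.eq_zero_or_pos s with rfl | hs1
  · exfalso
    have hbc : b ≤ c := by
      rw [hls] at hl
      omega
    -- For l = 1 and thus b ≤ c, use atoms (-ce)^y(be)^z with yc = zb, of norm y. They exclude (c,
    -- b) = (3, 2) and (4, 3); otherwise b does not divide n.
    have small : ∀ y z : ℕ, y ≤ 4 → z ≤ 4 → 0 < y → 0 < z → y * c = z * b →
        (∀ y' z', y' ≤ y → z' ≤ z → y' * c = z' * b → (y' = 0 ∧ z' = 0) ∨ (y' = y ∧ z' = z)) →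
        y = 1 := by
      intro y z hy hz hy0 hz0 hyz hmin
      have hyzz : (y : ℤ) * c = z * b := by exact_mod_cast hyz
      have h1 := W.triple_dvd (x := 0) (y := y) (z := z) (l := y) (by omega) he heG hhG hbG
        (by omega) (by omega) hb0 (by omega) (by omega) (by
          zify
          linear_combination -(y : ℤ) * haz - hyzz) (by
          intro x' y' z' hx' hy' hz' hd
          obtain rfl : x' = 0 := by omega
          have h2 : (n : ℤ) ∣ (0 : ℕ) + y' * a + z' * b := by exact_mod_cast hd
          have h3 := dvd_sub (Dvd.intro_left (y' : ℤ) rfl : (n : ℤ) ∣ y' * n) h2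
          rw [show (y' * n - ((0 : ℕ) + y' * a + z' * b) : ℤ) = y' * c - z' * b by
            push_cast; linear_combination (y' : ℤ) * haz] at h3
          have h4 : y' * c ≤ 4 * 4 := Nat.mul_le_mul (by omega) hc4
          have h5 : z' * b ≤ 4 * 4 := Nat.mul_le_mul (by omega) (by omega)
          have h6 := Int.eq_zero_of_abs_lt_dvd h3 (by
            rw [abs_lt]
            zify at h4 h5
            have h7 : (0 : ℤ) ≤ y' * c := by positivity
            have h8 : (0 : ℤ) ≤ z' * b := by positivity
            constructor <;> omega)
          have h7 : y' * c = z' * b := by zify; omega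
          rcases hmin y' z' hy' hz' h7 with h | h
          · exact Or.inl ⟨rfl, h⟩
          · exact Or.inr ⟨rfl, h⟩)
      have := Int.eq_zero_of_dvd_of_nonneg_of_lt (m := (y : ℤ) - 1) (n := (D : ℤ)) (by omega)
        (by omega) h1
      omega
    unfold IsExceptional at hct
    rcases hct with ⟨rfl, -⟩ | ⟨rfl, rfl | rfl⟩ | ⟨rfl, rfl⟩ | ⟨rfl, rfl⟩
    · omega
    · obtain rfl : b = 2 := by omega
      omega
    · obtain rfl : b = 2 := by omega
      omega
    · rcases (show b = 2 ∨ b = 3 by omega) with rfl | rfl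
      · have := small 2 3 (by omega) (by omega) (by omega) (by omega) rfl (by omega)
        omega
      · omega
    · rcases (show b = 2 ∨ b = 3 ∨ b = 4 by omega) with rfl | rfl | rfl
      · omega
      · have := small 3 4 (by omega) (by omega) (by omega) (by omega) rfl (by omega)
        omega
      · omega
  · obtain ⟨r, hr⟩ : ∃ r, c = r + x := ⟨c - x, by omega⟩
    have hbr : b = c * s * D + r := by
      have h1 : l * c = c * s * D + c := by rw [hls]; ring
      omega
    -- Both sides equal n. The remainders are below D, so ks = t and kr = c + 1; in the exceptional
    -- list k ≥ 2 divides both t and c + 1 only for c = 1, where k = 2.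
    have hkb : k * c * s * D + k * r = c * t * D + (c + 1) := by
      rw [hbr] at hbk
      rw [← add_assoc, ← hn, hbk]; ring
    have hk9 : k ≤ 9 := by
      have h1 : k * 1 * 1 * D ≤ k * c * s * D :=
        Nat.mul_le_mul_right _ (Nat.mul_le_mul (Nat.mul_le_mul_left _ hc0) hs1)
      have h2 : k * 1 ≤ k * r := Nat.mul_le_mul_left _ (by omega)
      by_contra h3
      have h4 : 10 * D ≤ k * D := Nat.mul_le_mul_right _ (by omega)
      rw [mul_one, mul_one] at h1
      omega
    have hkr : k * r ≤ 9 * 4 := Nat.mul_le_mul hk9 (by omega)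
    obtain ⟨h1, h2⟩ := eq_and_eq_of_mul_add_eq (by omega) (by omega) hkb
    have h3 : k * s = t := by
      refine Nat.eq_of_mul_eq_mul_left hc0 ?_
      rw [← h1]; ring
    have h4 : k ∣ c + 1 := Dvd.intro _ h2
    have h5 : k ∣ t := Dvd.intro _ h3
    unfold IsExceptional at hct
    rcases hct with ⟨rfl, -⟩ | ⟨rfl, rfl | rfl⟩ | ⟨rfl, rfl⟩ | ⟨rfl, rfl⟩
    · have h6 := Nat.le_of_dvd (by omega) h4
      obtain rfl : k = 2 := by omega
      exact ⟨rfl, hbk⟩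
    all_goals
      exfalso
      interval_cases k <;> omega

end Forward

section Forward

universe v

variable {G : Type v} [AddCommGroup G] {G₀ : Set G} {D : ℕ}

theorem IsLengthGenerator.dvd_of_lengthsCongr (h : IsLengthGenerator G₀ D) {k : ℕ}
    (hk : LengthsCongr G₀ k) : k ∣ D := by
  obtain ⟨z, z', hz, hz', hsum, hcard⟩ := h.attained
  have h1 := hk z z' hz hz' hsum
  rw [hcard, add_sub_cancel_left] at h1
  exact_mod_cast h1

/-- In the exceptional case μ = n/N is 1, so both elements generate G, and either h = -cg (if q = 1)
or g = -ch (if ρ = 1). -/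
theorem IsLengthWeight.pair_structure_of_not_mem_gcdSet {X : Type v} [AddCommGroup X]
    {θ : G → X} {u : X} [Finite G] [IsAddCyclic G] (W : IsLengthWeight G₀ D θ u)
    (hD : 200 ≤ D) (hn : Nat.card G ≤ 10 * D) (hne : ∀ m, m ∣ Nat.card G → D ∉ gcdSet m)
    {g h : G} {N x y α : ℕ} (P : PairData g h N x y α) (hg : g ∈ G₀) (hh : h ∈ G₀) (hα : α ≠ 1) :
    N = Nat.card G ∧ x = 1 ∧ y = 1 ∧ ∃ c t,
      (α = Nat.card G - c ∨ (α = t * D + 1 ∧ c * α + 1 = Nat.card G)) ∧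
      Nat.card G = c * t * D + c + 1 ∧ IsExceptional c t := by
  have hxn : N * x ∣ Nat.card G := P.order_left ▸ addOrderOf_dvd_natCard g
  have hyn : N * y ∣ Nat.card G := P.order_right ▸ addOrderOf_dvd_natCard h
  obtain ⟨μ, hμ⟩ : N ∣ Nat.card G := (Dvd.intro _ rfl).trans hxn
  have hn0 : 0 < Nat.card G := Nat.card_pos
  have hμ0 : 0 < μ := Nat.pos_of_ne_zero fun h => by rw [h] at hμ; omega
  have hNn : N ≤ Nat.card G := Nat.le_of_dvd hn0 ⟨μ, hμ⟩
  obtain ⟨q, ρ, t, hq, hρ, ht, hN, hαt⟩ := W.pair_structure P hg hh hα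
    (hNn.trans (hn.trans (Nat.mul_le_mul_right _ (by omega))))
  rcases mem_gcdSet_or_isExceptional (n := Nat.card G) (μ := μ) (by omega) hn hμ0 hq hρ ht
    (by rw [hμ, hN, hαt, mul_comm]) with ⟨m, hm, hmD⟩ | ⟨rfl, c, hc, hnc, hct⟩
  · exact absurd hmD (hne m hm)
  · rw [mul_one] at hμ
    have one : ∀ x, N * x ∣ Nat.card G → x = 1 := by
      intro x hx
      rw [hμ] at hx
      nth_rewrite 2 [← mul_one N] at hx
      exact Nat.dvd_one.1 (Nat.dvd_of_mul_dvd_mul_left P.pos hx)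
    refine ⟨hμ.symm, one x hxn, one y hyn, c, t, ?_, hnc, hct⟩
    rcases hc with ⟨rfl, rfl⟩ | ⟨rfl, rfl⟩
    · left
      omega
    · right
      exact ⟨by rw [hαt]; ring, by rw [hμ, hN]⟩

theorem IsLengthGenerator.exists_mem_gcdSet [Finite G] [IsAddCyclic G] (h : IsLengthGenerator G₀ D)
    (hG : 2000 ≤ Nat.card G) (hn : Nat.card G ≤ 10 * D) :
    ∃ m, m ∣ Nat.card G ∧ D ∈ gcdSet m := by
  by_contra! hne
  have hD : 200 ≤ D := by omega
  obtain ⟨X, _, θ, u, W⟩ := h.exists_isLengthWeight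
  obtain ⟨n, hnG⟩ : ∃ n, Nat.card G = n := ⟨_, rfl⟩
  have full := fun {g h N x y α} => W.pair_structure_of_not_mem_gcdSet (g := g) (h := h) (N := N)
    (x := x) (y := y) (α := α) hD hn hne
  rw [hnG] at full hG hn
  obtain ⟨e, c, t, he, heG, hhG, hnc, hct⟩ : ∃ (e : G) (c t : ℕ), addOrderOf e = n ∧ e ∈ G₀ ∧
      (n - c) • e ∈ G₀ ∧ n = c * t * D + c + 1 ∧ IsExceptional c t := by
    obtain ⟨g, hg, k, hk, N, x, y, α, P, hα⟩ := h.exists_pairData_ne_one (by omega) (hnG ▸ hn)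
    obtain ⟨rfl, rfl, rfl, c, t, hc, hnc, hct⟩ := full P hg hk hα
    have hoe := P.order_left
    have hok := P.order_right
    have heq := P.eq
    rw [mul_one] at hoe hok
    rw [one_nsmul, one_nsmul] at heq
    rcases hc with rfl | ⟨-, hc⟩
    · exact ⟨g, c, t, hoe, hg, heq ▸ hk, hnc, hct⟩
    · refine ⟨k, c, t, hok, hk, ?_, hnc, hct⟩
      have h1 : (c * α + 1) • g = 0 := by rw [hc, ← hoe, addOrderOf_nsmul_eq_zero]
      have h2 : N • k = 0 := by rw [← hok, addOrderOf_nsmul_eq_zero]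
      have h3 : (N - c) • k + c • k = 0 := by
        rw [← add_nsmul, Nat.sub_add_cancel (by omega), h2]
      have h4 : g + c • k = 0 := by
        rw [heq, ← mul_nsmul', add_comm, ← succ_nsmul, h1]
      rwa [add_right_cancel (h3.trans h4.symm)]
  have hc0 : 0 < c := by unfold IsExceptional at hct; omega
  have hc4 : c ≤ 4 := by unfold IsExceptional at hct; omega
  have ht2 : 2 ≤ t := by unfold IsExceptional at hct; omega
  have ht3 : c = 1 → 3 ≤ t := by unfold IsExceptional at hct; omega
  -- Compare f with the generator e: for α = 1, f = xe with x ∣ n and `eq_of_dvd` applies; for α ≠ 1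
  -- the pair (c, t) is the same as before, by uniqueness of the digits of n in base D.
  have cover : ∀ f ∈ G₀,
      f = 0 ∨ f = e ∨ f = (n - c) • e ∨ (c = 1 ∧ ∃ b, n = b * 2 ∧ f = b • e) := by
    intro f hf
    obtain ⟨N, x, y, α, P⟩ := exists_pairData e f
    have hx := P.order_left
    have hy := P.order_right
    have heq := P.eq
    rw [he] at hx
    have hy1 : y = 1 := by
      have h1 : N * y ∣ N * x := by
        rw [← hx, ← hy, ← hnG]
        exact addOrderOf_dvd_natCard f
      exact Nat.Coprime.eq_one_of_dvd P.coprime.symm (Nat.dvd_of_mul_dvd_mul_left P.pos h1)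
    rw [hy1, one_nsmul] at heq
    by_cases hα : α = 1
    · rw [hα, one_nsmul] at heq
      by_cases h1 : x = 1
      · right; left
        rw [heq, h1, one_nsmul]
      by_cases h2 : x = n
      · left
        rw [heq, h2, ← he, addOrderOf_nsmul_eq_zero]
      · obtain ⟨h3, h4⟩ := W.eq_of_dvd hD hn he heG hhG (heq ▸ hf) hnc hct (by rw [hx, mul_comm])
          h1 h2
        exact Or.inr (Or.inr (Or.inr ⟨h3, x, h4, heq⟩))
    · right; right; left
      obtain ⟨-, rfl, -, c', t', hc, hnc', hct'⟩ := full P heG hf hα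
      rw [one_nsmul] at heq
      obtain ⟨h1, h2⟩ := eq_and_eq_of_mul_add_eq (D := D) (a := c * t) (b := c' * t') (r := c + 1)
        (s := c' + 1) (by omega) (by unfold IsExceptional at hct'; omega) (by omega)
      obtain rfl : c' = c := by omega
      obtain rfl : t' = t := (Nat.eq_of_mul_eq_mul_left hc0 h1).symm
      rcases hc with rfl | ⟨h3, h4⟩
      · exact heq
      · by_cases h5 : c' = 1
        · subst h5
          rw [heq, show α = n - 1 by omega]
        · have h6 : c' * c' ≤ 4 * 4 := Nat.mul_le_mul hc4 hc4
          exact absurd (heq ▸ hf) (W.not_mem_of_mul_add_one he heG hhG (by omega) (by omega)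
            (by omega) h3 h4.symm (by omega))
  -- Here n = 1·(1 + ctD) + c and -ce = (1 + ctD)e, so the first half applies with q = 1 and ρ = c.
  have contra : ∀ κ k : ℕ, 0 < κ → 0 < k → κ ∣ n → Nat.lcm c κ * k = c * (t * D) →
      (∀ f ∈ G₀, f = 0 ∨ f = e ∨ f = (n - c) • e ∨ f = (n / κ) • e) → k ∣ D := by
    intro κ k hκ hk hκn hkt hcov
    refine h.dvd_of_lengthsCongr ?_
    refine (lengthsCongr_triple (q := 1) (ρ := c) (κ := κ) one_pos hc0 hκ hk he ?_ hκn).mono ?_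
    · rw [hkt, hnc]; ring
    · intro f hf
      have h1 : n - c = 1 + Nat.lcm c κ * k := by
        rw [hkt, ← mul_assoc]; omega
      have := hcov f hf
      rwa [h1] at this
  have h2D : 2 * D ≤ t * D := Nat.mul_le_mul_right _ ht2
  -- For c = 1 and n = 2b even, the element of order two requires κ = 2, and k = b - 1 = tD/2 > D
  -- because t ≥ 3. Otherwise κ = 1 and k = tD ≥ 2D.
  by_cases hpar : c = 1 ∧ 2 ∣ n
  · obtain ⟨rfl, b, hb⟩ := hpar
    have h3D : 3 * D ≤ t * D := Nat.mul_le_mul_right _ (ht3 rfl)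
    rw [one_mul] at hnc
    have := contra 2 (b - 1) two_pos (by omega) ⟨b, hb⟩ (by
      rw [Nat.lcm_one_left]; omega) (fun f hf => by
        rcases cover f hf with h | h | h | ⟨-, b', hb', h⟩
        · exact Or.inl h
        · exact Or.inr (Or.inl h)
        · exact Or.inr (Or.inr (Or.inl h))
        · right; right; right
          rw [h, hb', Nat.mul_div_cancel _ two_pos])
    have := Nat.le_of_dvd (by omega) this
    omega
  · have := contra 1 (t * D) one_pos (by omega) (one_dvd _) (by
      rw [Nat.lcm_one_right]) (fun f hf => by
        rcases cover f hf with h | h | h | ⟨h1, b', hb', h⟩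
        · exact Or.inl h
        · exact Or.inr (Or.inl h)
        · exact Or.inr (Or.inr (Or.inl h))
        · exact absurd ⟨h1, Dvd.intro_left _ hb'.symm⟩ hpar)
    have := Nat.le_of_dvd (by omega) this
    omega

end Forward

end Factorization

theorem mainTheorem1 (G : Type*) [AddCommGroup G] [Finite G] [IsAddCyclic G]
    (hG : 2000 ≤ Nat.card G) :
    Factorization.groupMinimalDistances G ∩ {k : ℕ | (Nat.card G : ℚ) / 10 ≤ (k : ℚ)} =
      (⋃ (m : ℕ) (_ : m ∣ Nat.card G), Factorization.gcdSet m) ∩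
        {k : ℕ | (Nat.card G : ℚ) / 10 ≤ (k : ℚ)} := by
  ext k
  simp only [Set.mem_inter_iff, Set.mem_iUnion, exists_prop, Set.mem_ofPred_eq]
  refine and_congr_left fun hk => ⟨fun h => ?_, ?_⟩
  · rw [div_le_iff₀ (by norm_num)] at hk
    have hn : Nat.card G ≤ 10 * k := by
      rw [mul_comm]
      exact_mod_cast hk
    obtain ⟨G₀, h⟩ := Factorization.mem_groupMinimalDistances_iff.1 h
    exact h.exists_mem_gcdSet hG hn
  · rintro ⟨m, hm, h⟩
    exact Factorization.gcdSet_subset_groupMinimalDistances hm h
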